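/- Let $\mathcal H_{A'},\mathcal H_{B'},\mathcal H_E$ be complex Hilbert spaces, and let $p_{XY}$ be a probability distribution on $\{0,1\}^2$. A (single-round 2-2-2) measurement strategy on $(\mathcal H_{A'},\mathcal H_{B'})$ consists of two-outcome POVMs $\{M_{a|x}\}_{a\in\{0,1\}}$ on $\mathcal H_{A'}$ for $x\in\{0,1\}$ and $\{N_{b|y}\}_{b\in\{0,1\}}$ on $\mathcal H_{B'}$ for $y\in\{0,1\}$; it is projective if all $M_{a|x}$ and $N_{b|y}$ are projectors. With $\mathcal N$ the channel associated with the strategy and $p_{XY}$, a density operator $\rho$ on $\mathcal H_{A'}\otimes\mathcal H_{B'}\otimes\mathcal H_E$ is sent to the post-measurement state $$(\mathcal N\otimes\mathcal I_E)(\rho)=\sum_{a,b,x,y}p_{XY}(x,y)\,|a\rangle\langle a|\otimes|b\rangle\langle b|\otimes|x\rangle\langle x|\otimes|y\rangle\langle y|\otimes\operatorname{tr}_{A'B'}\big((M_{a|x}\otimes N_{b|y}\otimes 1_E)\rho\big)$$ on $\mathbb C^2\otimes\mathbb C^2\otimes\mathbb C^2\otimes\mathbb C^2\otimes\mathcal H_E$.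 Let a measurement strategy on $(\mathcal H_{A'},\mathcal H_{B'})$ with associated channel $\mathcal N$ and a density operator $\rho$ on $\mathcal H_{A'}\otimes\mathcal H_{B'}\otimes\mathcal H_E$ be given. (1) Suppose that $\mathcal H_{A'}=\bigoplus_{\alpha\in I}\mathcal H^\alpha_{A'}$ and $\mathcal H_{B'}=\bigoplus_{\beta\in J}\mathcal H^\beta_{B'}$ are orthogonal decompositions into two-dimensional subspaces, with orthogonal projectors $\Pi^\alpha_{A'}$ and $\Pi^\beta_{B'}$, that the strategy is projective, that every $M_{a|x}$ preserves every $\mathcal H^\alpha_{A'}$ and every $N_{b|y}$ preserves every $\mathcal H^\beta_{B'}$, and that $$\rho=\sum_{\alpha,\beta}(\Pi^\alpha_{A'}\otimes\Pi^\beta_{B'}\otimes 1_E)\,\rho\,(\Pi^\alpha_{A'}\otimes\Pi^\beta_{B'}\otimes 1_E).$$ Then there are weights $p_\lambda\ge 0$, $\lambda\in I\times J$, with $\sum_\lambda p_\lambda=1$, measurement strategies on $(\mathbb C^2,\mathbb C^2)$ with associated channels $\mathcal N_\lambda$ for the same distribution $p_{XY}$, and density operators $\rho^\lambda$ on $\mathbb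 C^2\otimes\mathbb C^2\otimes\mathcal H_E$ such that $$(\mathcal N\otimes\mathcal I_E)(\rho)=\sum_\lambda p_\lambda\,(\mathcal N_\lambda\otimes\mathcal I_E)(\rho^\lambda).$$ (The combination is finite if there are finitely many blocks, and otherwise a norm-convergent series.) (2) Consequently, for an arbitrary measurement strategy on finite-dimensional $\mathcal H_{A'},\mathcal H_{B'}$ and an arbitrary density operator $\rho$ ($\mathcal H_E$ being any Hilbert space), the post-measurement state $(\mathcal N\otimes\mathcal I_E)(\rho)$ is a finite convex combination $\sum_\lambda p_\lambda(\mathcal N_\lambda\otimes\mathcal I_E)(\rho^\lambda)$ of post-measurement states of strategies in which both parties hold qubits, as in (1). -/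

import Mathlib

open scoped TensorProduct InnerProductSpace

noncomputable section

namespace BellStrategy

section HilbertTensor

variable (H K : Type*) [NormedAddCommGroup H] [InnerProductSpace ℂ H]
  [NormedAddCommGroup K] [InnerProductSpace ℂ K]

/-- The Hilbert space tensor product: the completion of the algebraic tensor product with respect
to the inner product with `⟪h ⊗ k, h' ⊗ k'⟫ = ⟪h, h'⟫ * ⟪k, k'⟫`. -/
abbrev HTensor : Type _ := UniformSpace.Completion (H ⊗[ℂ] K)

variable {H K}

/-- The operator `S ⊗ T` on the Hilbert space tensor product: the continuous extension of the
algebraic tensor product of the bounded operators `S` and `T`. -/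
def opTensor (S : H →L[ℂ] H) (T : K →L[ℂ] K) : HTensor H K →L[ℂ] HTensor H K :=
  ((UniformSpace.Completion.toComplL (𝕜 := ℂ) (E := H ⊗[ℂ] K)) ∘L
    TensorProduct.mapL S T).extend (UniformSpace.Completion.toComplL (𝕜 := ℂ) (E := H ⊗[ℂ] K))

/-- The bounded operator `K → H ⊗ K`, `k ↦ h ⊗ k`. -/
def ketTensor (h : H) : K →L[ℂ] HTensor H K :=
  (UniformSpace.Completion.toComplL (𝕜 := ℂ) (E := H ⊗[ℂ] K)) ∘L TensorProduct.mkL ℂ H K h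

end HilbertTensor

section States

variable {H K : Type*} [NormedAddCommGroup H] [InnerProductSpace ℂ H] [CompleteSpace H]
  [NormedAddCommGroup K] [InnerProductSpace ℂ K] [CompleteSpace K]

/-- Density operators: positive bounded operators with trace `1`, the trace being the sum of the
diagonal entries in any orthonormal (Hilbert) basis. -/
def IsDensity (ρ : H →L[ℂ] H) : Prop :=
  ρ.IsPositive ∧ ∀ (s : Set H) (b : HilbertBasis s ℂ H), HasSum (fun i => ⟪b i, ρ (b i)⟫_ℂ) 1

variable (H) in
/-- The index set of a chosen Hilbert basis of `H`. -/
def basisSet : Set H := (exists_hilbertBasis ℂ H).choose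

variable (H) in
/-- A chosen Hilbert basis of `H`. -/
def someBasis : HilbertBasis (basisSet H) ℂ H := (exists_hilbertBasis ℂ H).choose_spec.choose

/-- The partial trace over the first factor, `∑ᵢ (⟨bᵢ| ⊗ 1) T (|bᵢ⟩ ⊗ 1)` for a Hilbert basis
`(bᵢ)` of the first factor. For trace class `T`, the only case in which it is used, the series
converges absolutely in norm and its sum does not depend on the basis. -/
def partialTrace (T : HTensor H K →L[ℂ] HTensor H K) : K →L[ℂ] K :=
  ∑' i, (ContinuousLinearMap.adjoint (ketTensor (K := K) (someBasis H i))) ∘L T ∘L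
    ketTensor (someBasis H i)

end States

/-- The two-dimensional Hilbert space `ℂ²`. -/
abbrev Qubit : Type := EuclideanSpace ℂ (Fin 2)

/-- The projector `|i⟩⟨i|` onto the `i`-th computational basis vector of `ℂ²`. -/
def ketBra (i : Fin 2) : Qubit →L[ℂ] Qubit :=
  InnerProductSpace.rankOne ℂ (EuclideanSpace.single i (1 : ℂ)) (EuclideanSpace.single i (1 : ℂ))

section Strategies

variable (HA HB : Type*) [NormedAddCommGroup HA] [InnerProductSpace ℂ HA]
  [NormedAddCommGroup HB] [InnerProductSpace ℂ HB]

/-- A single-round 2-2-2 measurement strategy on `HA` and `HB`: for each input `x` a two-outcome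
POVM `(M x 0, M x 1)` on `HA`, and for each input `y` a two-outcome POVM `(N y 0, N y 1)`
on `HB`. -/
structure MeasurementStrategy where
  /-- `M x a` is the element `M_{a|x}`. -/
  M : Fin 2 → Fin 2 → (HA →L[ℂ] HA)
  /-- `N y b` is the element `N_{b|y}`. -/
  N : Fin 2 → Fin 2 → (HB →L[ℂ] HB)
  M_pos : ∀ x a, (M x a).IsPositive
  M_sum : ∀ x, ∑ a, M x a = 1
  N_pos : ∀ y b, (N y b).IsPositive
  N_sum : ∀ y, ∑ b, N y b = 1

variable {HA HB}

/-- All the POVMs of the strategy are projective. -/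
def MeasurementStrategy.IsProjective (S : MeasurementStrategy HA HB) : Prop :=
  (∀ x a, S.M x a * S.M x a = S.M x a) ∧ (∀ y b, S.N y b * S.N y b = S.N y b)

variable [CompleteSpace HA] [CompleteSpace HB] {HE : Type*} [NormedAddCommGroup HE]
  [InnerProductSpace ℂ HE] [CompleteSpace HE]

/-- The Hilbert space of the registers `A, B, X, Y` (four qubits) and of the system `E`. -/
abbrev OutSpace (HE : Type*) [NormedAddCommGroup HE] [InnerProductSpace ℂ HE] : Type _ :=
  HTensor (HTensor (HTensor (HTensor Qubit Qubit) Qubit) Qubit) HE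

/-- The post-measurement state
`∑ p(x,y) |a⟩⟨a| ⊗ |b⟩⟨b| ⊗ |x⟩⟨x| ⊗ |y⟩⟨y| ⊗ tr_{A'B'} ((M_{a|x} ⊗ N_{b|y} ⊗ 1) ρ)`
obtained by applying the channel associated with `S` and `p`, tensored with the identity channel
on `E`, to `ρ`. -/
def MeasurementStrategy.postMeasurement (S : MeasurementStrategy HA HB) (p : Fin 2 × Fin 2 → ℝ)
    (ρ : HTensor (HTensor HA HB) HE →L[ℂ] HTensor (HTensor HA HB) HE) :
    OutSpace HE →L[ℂ] OutSpace HE :=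
  ∑ a : Fin 2, ∑ b : Fin 2, ∑ x : Fin 2, ∑ y : Fin 2, (p (x, y) : ℂ) •
    opTensor (opTensor (opTensor (opTensor (ketBra a) (ketBra b)) (ketBra x)) (ketBra y))
      (partialTrace (opTensor (opTensor (S.M x a) (S.N y b)) (1 : HE →L[ℂ] HE) * ρ))

/-- `τ` is a convex combination, with weights indexed by `Λ`, of post-measurement states of
strategies in which both parties hold qubits, for the input distribution `p`. For infinite `Λ`
the combination is a series; since all its terms are positive and the traces add up, convergence
in operator norm to the state `τ` is the same as convergence in trace norm. -/
def IsQubitMixture (Λ : Type*) (p : Fin 2 × Fin 2 → ℝ) (τ : OutSpace HE →L[ℂ] OutSpace HE) :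
    Prop :=
  ∃ (w : Λ → ℝ) (S : Λ → MeasurementStrategy Qubit Qubit)
    (σ : Λ → (HTensor (HTensor Qubit Qubit) HE →L[ℂ] HTensor (HTensor Qubit Qubit) HE)),
    (∀ l, 0 ≤ w l) ∧ HasSum w 1 ∧ (∀ l, IsDensity (σ l)) ∧
      HasSum (fun l => (w l : ℂ) • (S l).postMeasurement p (σ l)) τ

end Strategies

section Blocks

/-- An orthogonal decomposition of the Hilbert space `H` into two-dimensional subspaces. -/
structure BlockDecomposition (ι H : Type*) [NormedAddCommGroup H] [InnerProductSpace ℂ H]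
    [CompleteSpace H] where
  block : ι → Submodule ℂ H
  finrank_block : ∀ i, Module.finrank ℂ (block i) = 2
  isHilbertSum : IsHilbertSum ℂ (fun i => block i) (fun i => (block i).subtypeₗᵢ)

instance finiteDimensional_block {ι H : Type*} [NormedAddCommGroup H] [InnerProductSpace ℂ H] [CompleteSpace H]
    (D : BlockDecomposition ι H) (i : ι) : FiniteDimensional ℂ (D.block i) :=
  FiniteDimensional.of_finrank_pos (by rw [D.finrank_block i]; norm_num)

/-- The orthogonal projector onto the `i`-th block. -/
def BlockDecomposition.proj {ι H : Type*} [NormedAddCommGroup H] [InnerProductSpace ℂ H]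
    [CompleteSpace H] (D : BlockDecomposition ι H) (i : ι) : H →L[ℂ] H :=
  (D.block i).starProjection

variable {ι κ HA HB HE : Type*} [NormedAddCommGroup HA] [InnerProductSpace ℂ HA] [CompleteSpace HA]
  [NormedAddCommGroup HB] [InnerProductSpace ℂ HB] [CompleteSpace HB]
  [NormedAddCommGroup HE] [InnerProductSpace ℂ HE] [CompleteSpace HE]

/-- The strategy is projective, and its projectors are block diagonal with respect to the given
decompositions of `HA` and `HB` into two-dimensional blocks. -/
def MeasurementStrategy.IsBlockDiagonal (S : MeasurementStrategy HA HB)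
    (D : BlockDecomposition ι HA) (D' : BlockDecomposition κ HB) : Prop :=
  S.IsProjective ∧ (∀ x a i, ∀ v ∈ D.block i, S.M x a v ∈ D.block i) ∧
    (∀ y b j, ∀ v ∈ D'.block j, S.N y b v ∈ D'.block j)

/-- `ρ = ∑ (Π^α ⊗ Π^β ⊗ 1) ρ (Π^α ⊗ Π^β ⊗ 1)`, the sum running over all pairs of blocks. -/
def IsBlockState (D : BlockDecomposition ι HA) (D' : BlockDecomposition κ HB)
    (ρ : HTensor (HTensor HA HB) HE →L[ℂ] HTensor (HTensor HA HB) HE) : Prop :=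
  HasSum (fun l : ι × κ =>
    opTensor (opTensor (D.proj l.1) (D'.proj l.2)) (1 : HE →L[ℂ] HE) * ρ *
      opTensor (opTensor (D.proj l.1) (D'.proj l.2)) (1 : HE →L[ℂ] HE)) ρ

end Blocks

end BellStrategy

end

/-!
The POVMs of each party are C⋆-convex combinations `M_{a|x} = ∑ᵢ Cᵢ† Q_{i,a|x} Cᵢ` of qubit POVMs
with operators `Cᵢ` independent of `a` and `x`. If the `M_{a|x}` preserve blocks of dimension at
most two, `Cᵢ` is a partial isometry which projects onto the `i`-th block and identifies it with a
subspace of `ℂ²`. In finite dimension, two projections split the space into such blocks (Jordan's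
lemma), and general effects are convex combinations of projections.

Since `tr_{A'B'}` is cyclic in `A'B'`, the operators `Cᵢ ⊗ C'ⱼ` can be moved onto the state: with
`K = Cᵢ ⊗ C'ⱼ ⊗ 1`, the weights are the traces of the compressed states `K ρ K†`, and the qubit
states are these operators normalized. The convergence of all the series follows from that of
scalar series of nonnegative terms, because `ρ = ∑ₖ |vₖ⟩⟨vₖ|` with `∑ₖ ‖vₖ‖² = 1`.
-/

noncomputable section

namespace BellStrategy

open ContinuousLinearMap

section TensorMap

variable {H K H' K' H'' K'' F : Type*}
  [NormedAddCommGroup H] [InnerProductSpace ℂ H] [NormedAddCommGroup K] [InnerProductSpace ℂ K]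
  [NormedAddCommGroup H'] [InnerProductSpace ℂ H'] [NormedAddCommGroup K'] [InnerProductSpace ℂ K']
  [NormedAddCommGroup H''] [InnerProductSpace ℂ H'']
  [NormedAddCommGroup K''] [InnerProductSpace ℂ K'']
  [NormedAddCommGroup F] [NormedSpace ℂ F]

/-- The bounded operator `S ⊗ T : H ⊗ K → H' ⊗ K'`. It extends `opTensor` to operators between
different spaces, which is needed to compress states. -/
def tensorMap (S : H →L[ℂ] H') (T : K →L[ℂ] K') : HTensor H K →L[ℂ] HTensor H' K' :=
  ((UniformSpace.Completion.toComplL (𝕜 := ℂ) (E := H' ⊗[ℂ] K')) ∘L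
    TensorProduct.mapL S T).extend (UniformSpace.Completion.toComplL (𝕜 := ℂ) (E := H ⊗[ℂ] K))

/-- The bounded operator `H → H ⊗ K`, `h ↦ h ⊗ k`; its adjoint is the slice map `1 ⊗ ⟨k|`. -/
def tensorKet (k : K) : H →L[ℂ] HTensor H K :=
  (UniformSpace.Completion.toComplL (𝕜 := ℂ) (E := H ⊗[ℂ] K)) ∘L (TensorProduct.mkL ℂ H K).flip k

theorem opTensor_eq_tensorMap (S : H →L[ℂ] H) (T : K →L[ℂ] K) : opTensor S T = tensorMap S T := rfl

theorem ketTensor_apply (h : H) (k : K) :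
    ketTensor h k = ((h ⊗ₜ[ℂ] k : H ⊗[ℂ] K) : HTensor H K) := rfl

theorem tensorKet_apply (k : K) (h : H) : tensorKet k h = ketTensor h k := rfl

theorem tensorMap_coe (S : H →L[ℂ] H') (T : K →L[ℂ] K') (x : H ⊗[ℂ] K) :
    tensorMap S T (x : HTensor H K) = (TensorProduct.mapL S T x : H' ⊗[ℂ] K') :=
  ContinuousLinearMap.extend_eq
    ((UniformSpace.Completion.toComplL (𝕜 := ℂ) (E := H' ⊗[ℂ] K')) ∘L TensorProduct.mapL S T)
    UniformSpace.Completion.denseRange_coe (UniformSpace.Completion.isUniformInducing_coe _) x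

@[simp]
theorem tensorMap_ketTensor (S : H →L[ℂ] H') (T : K →L[ℂ] K') (h : H) (k : K) :
    tensorMap S T (ketTensor h k) = ketTensor (S h) (T k) := by
  rw [ketTensor_apply, tensorMap_coe]; rfl

theorem inner_ketTensor (h h' : H) (k k' : K) :
    ⟪ketTensor h k, ketTensor h' k'⟫_ℂ = ⟪h, h'⟫_ℂ * ⟪k, k'⟫_ℂ := by
  simp [ketTensor_apply, UniformSpace.Completion.inner_coe]

theorem norm_ketTensor (h : H) (k : K) : ‖ketTensor h k‖ = ‖h‖ * ‖k‖ := by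
  simp [ketTensor_apply]

theorem ext_ketTensor {S T : HTensor H K →L[ℂ] F}
    (h : ∀ u v, S (ketTensor u v) = T (ketTensor u v)) : S = T := by
  refine ContinuousLinearMap.ext fun x => ?_
  induction x using UniformSpace.Completion.induction_on with
  | hp => exact isClosed_eq S.continuous T.continuous
  | ih x =>
    induction x using TensorProduct.induction_on with
    | zero => simp only [UniformSpace.Completion.coe_zero, map_zero]
    | tmul u v => exact h u v
    | add x y hx hy => rw [UniformSpace.Completion.coe_add, map_add, map_add, hx, hy]

theorem ext_inner_ketTensor {x y : HTensor H K}
    (h : ∀ u v, ⟪ketTensor u v, x⟫_ℂ = ⟪ketTensor u v, y⟫_ℂ) : x = y := by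
  refine (InnerProductSpace.toDual ℂ (HTensor H K)).injective (ext_ketTensor fun u v => ?_)
  simpa using congrArg (starRingEnd ℂ) (h u v)

theorem tensorMap_one_one : tensorMap (1 : H →L[ℂ] H) (1 : K →L[ℂ] K) = 1 :=
  ext_ketTensor fun u v => by simp

theorem tensorMap_comp (S : H →L[ℂ] H') (T : K →L[ℂ] K') (S' : H' →L[ℂ] H'') (T' : K' →L[ℂ] K'') :
    tensorMap (S' ∘L S) (T' ∘L T) = tensorMap S' T' ∘L tensorMap S T :=
  ext_ketTensor fun u v => by simp

theorem norm_tensorMap_le (S : H →L[ℂ] H') (T : K →L[ℂ] K') : ‖tensorMap S T‖ ≤ ‖S‖ * ‖T‖ := by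
  refine ContinuousLinearMap.opNorm_le_bound _ (by positivity) fun x => ?_
  induction x using UniformSpace.Completion.induction_on with
  | hp => exact isClosed_le (by fun_prop) (by fun_prop)
  | ih x =>
    rw [tensorMap_coe, UniformSpace.Completion.norm_coe, UniformSpace.Completion.norm_coe]
    exact ContinuousLinearMap.le_of_opNorm_le _ (TensorProduct.norm_mapL_le S T) x

theorem norm_tensorMap_one_le (S : H →L[ℂ] H') : ‖tensorMap S (1 : K →L[ℂ] K)‖ ≤ ‖S‖ :=
  (norm_tensorMap_le S 1).trans (mul_le_of_le_one_right (norm_nonneg _) norm_id_le)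

/-- The bounded linear map `T ↦ S ⊗ T`. -/
def tensorMapRight (S : H →L[ℂ] H') : (K →L[ℂ] K') →L[ℂ] (HTensor H K →L[ℂ] HTensor H' K') :=
  LinearMap.mkContinuous
    { toFun := tensorMap S
      map_add' := fun T T' => ext_ketTensor fun u v => by simp
      map_smul' := fun c T => ext_ketTensor fun u v => by simp } ‖S‖
    fun T => norm_tensorMap_le S T

theorem tensorMapRight_apply (S : H →L[ℂ] H') (T : K →L[ℂ] K') :
    tensorMapRight S T = tensorMap S T := rfl

theorem tensorMap_sum_sum {A B : Type*} [Fintype A] [Fintype B] (S : A → H →L[ℂ] H')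
    (T : B → K →L[ℂ] K') :
    tensorMap (∑ a, S a) (∑ b, T b) = ∑ c : A × B, tensorMap (S c.1) (T c.2) :=
  ext_ketTensor fun u v => by
    simp only [tensorMap_ketTensor, sum_apply, Fintype.sum_prod_type, map_sum]
    simp only [← tensorKet_apply, map_sum]
    exact Finset.sum_comm

/-- The isometry `k ↦ h ⊗ k` for a unit vector `h`. -/
def ketTensorIsometry {h : H} (hh : ‖h‖ = 1) : K →ₗᵢ[ℂ] HTensor H K where
  toLinearMap := (ketTensor h : K →L[ℂ] HTensor H K)
  norm_map' k := by rw [coe_coe, norm_ketTensor, hh, one_mul]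

theorem ketTensorIsometry_toContinuousLinearMap {h : H} (hh : ‖h‖ = 1) :
    (ketTensorIsometry hh : K →ₗᵢ[ℂ] HTensor H K).toContinuousLinearMap = ketTensor h := rfl

theorem orthogonalFamily_ketTensorIsometry {ι : Type*} {b : ι → H} (hb : Orthonormal ℂ b) :
    OrthogonalFamily ℂ (fun _ : ι => K) fun i => ketTensorIsometry (hb.1 i) :=
  fun i j hij u v => (inner_ketTensor (b i) (b j) u v).trans (by rw [hb.2 hij, zero_mul])

section Adjoint

variable [CompleteSpace H] [CompleteSpace K] [CompleteSpace H'] [CompleteSpace K']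

theorem adjoint_tensorMap (S : H →L[ℂ] H') (T : K →L[ℂ] K') :
    adjoint (tensorMap S T) = tensorMap (adjoint S) (adjoint T) :=
  ext_ketTensor fun u v => ext_inner_ketTensor fun u' v' => by
    simp only [adjoint_inner_right, tensorMap_ketTensor, inner_ketTensor]

theorem tensorMap_adjoint_conj (Q : H' →L[ℂ] H') (C : H →L[ℂ] H') (Q' : K' →L[ℂ] K')
    (C' : K →L[ℂ] K') :
    tensorMap (adjoint C ∘L Q ∘L C) (adjoint C' ∘L Q' ∘L C') =
      adjoint (tensorMap C C') ∘L tensorMap Q Q' ∘L tensorMap C C' := by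
  rw [adjoint_tensorMap, tensorMap_comp, tensorMap_comp]

theorem isPositive_tensorMap {S : H →L[ℂ] H} {T : K →L[ℂ] K} (hS : S.IsPositive)
    (hT : T.IsPositive) : (tensorMap S T).IsPositive := by
  obtain ⟨R, rfl⟩ := CStarAlgebra.nonneg_iff_eq_star_mul_self.mp
    ((nonneg_iff_isPositive S).mpr hS)
  obtain ⟨R', rfl⟩ := CStarAlgebra.nonneg_iff_eq_star_mul_self.mp
    ((nonneg_iff_isPositive T).mpr hT)
  rw [mul_def, mul_def, tensorMap_comp, star_eq_adjoint, star_eq_adjoint, ← adjoint_tensorMap]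
  exact isPositive_adjoint_comp_self _

end Adjoint

section Slices

variable [CompleteSpace H]

theorem norm_adjoint_tensorKet_apply_le (k : K) (x : HTensor H K) :
    ‖adjoint (tensorKet k) x‖ ≤ ‖k‖ * ‖x‖ := by
  refine ContinuousLinearMap.le_of_opNorm_le _ ?_ x
  rw [LinearIsometryEquiv.norm_map]
  exact ContinuousLinearMap.opNorm_le_bound _ (norm_nonneg _) fun h => by
    rw [tensorKet_apply, norm_ketTensor, mul_comm]

variable [CompleteSpace K]

theorem adjoint_tensorKet_tensorMap_one [CompleteSpace H'] (S : H →L[ℂ] H') (k : K)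
    (x : HTensor H K) :
    adjoint (tensorKet k) (tensorMap S 1 x) = S (adjoint (tensorKet k) x) :=
  ext_inner_left ℂ fun u => by
    rw [adjoint_inner_right, ← adjoint_inner_left S, adjoint_inner_right, ← adjoint_inner_left,
      adjoint_tensorMap, tensorKet_apply, tensorKet_apply, tensorMap_ketTensor, adjoint_one,
      one_apply_eq_self]

theorem inner_adjoint_ketTensor (h : H) (k : K) (x : HTensor H K) :
    ⟪k, adjoint (ketTensor h) x⟫_ℂ = ⟪h, adjoint (tensorKet k) x⟫_ℂ := by
  rw [adjoint_inner_right, adjoint_inner_right, tensorKet_apply]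

end Slices

end TensorMap

section HilbertSpace

variable {H : Type*} [NormedAddCommGroup H] [InnerProductSpace ℂ H]

theorem inner_self_eq_ofReal (x : H) : ⟪x, x⟫_ℂ = ((‖x‖ ^ 2 : ℝ) : ℂ) := by
  rw [inner_self_eq_norm_sq_to_K, Complex.ofReal_pow]; rfl

theorem inner_mul_inner_swap (x y : H) : ⟪x, y⟫_ℂ * ⟪y, x⟫_ℂ = ((‖⟪y, x⟫_ℂ‖ ^ 2 : ℝ) : ℂ) := by
  rw [← inner_conj_symm, Complex.conj_mul', Complex.ofReal_pow]

theorem hasSum_prod_of_nonneg {α β : Type*} {f : α × β → ℝ} {g : α → ℝ} {c : ℝ}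
    (hf : ∀ p, 0 ≤ f p) (hfg : ∀ a, HasSum (fun b => f (a, b)) (g a)) (hg : HasSum g c) :
    HasSum f c := by
  have hs : Summable f := (summable_prod_of_nonneg hf).mpr
    ⟨fun a => (hfg a).summable, by simpa only [(hfg _).tsum_eq] using hg.summable⟩
  rw [hg.unique (hs.hasSum.prod_fiberwise hfg)]
  exact hs.hasSum

theorem hasSum_prod_swap {α β M : Type*} [AddCommMonoid M] [TopologicalSpace M] {f : α × β → M}
    {c : M} (h : HasSum f c) : HasSum (fun p : β × α => f p.swap) c :=
  (Equiv.prodComm β α).hasSum_iff.mpr h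

theorem sum_norm_sq_adjoint_le {ι : Type*} {G : ι → Type*} [∀ i, NormedAddCommGroup (G i)]
    [∀ i, InnerProductSpace ℂ (G i)] [∀ i, CompleteSpace (G i)] [CompleteSpace H]
    {V : ∀ i, G i →ₗᵢ[ℂ] H} (hV : OrthogonalFamily ℂ G V) (x : H) (s : Finset ι) :
    ∑ i ∈ s, ‖adjoint (V i).toContinuousLinearMap x‖ ^ 2 ≤ ‖x‖ ^ 2 := by
  set y : ∀ i, G i := fun i => adjoint (V i).toContinuousLinearMap x
  set z : H := ∑ i ∈ s, V i (y i)
  have hz : ‖z‖ ^ 2 = ∑ i ∈ s, ‖y i‖ ^ 2 := hV.norm_sum y s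
  have hzx : RCLike.re ⟪z, x⟫_ℂ = ∑ i ∈ s, ‖y i‖ ^ 2 := by
    rw [sum_inner, map_sum]
    refine Finset.sum_congr rfl fun i _ => ?_
    rw [← LinearIsometry.coe_toContinuousLinearMap, ← adjoint_inner_right,
      inner_self_eq_norm_sq (𝕜 := ℂ)]
  have hsub : ‖z - x‖ ^ 2 = ‖z‖ ^ 2 - 2 * RCLike.re ⟪z, x⟫_ℂ + ‖x‖ ^ 2 := norm_sub_sq z x
  linarith [sq_nonneg ‖z - x‖]

theorem summable_norm_sq_adjoint {ι κ : Type*} {G : ι → Type*} [∀ i, NormedAddCommGroup (G i)]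
    [∀ i, InnerProductSpace ℂ (G i)] [∀ i, CompleteSpace (G i)] [CompleteSpace H]
    {V : ∀ i, G i →ₗᵢ[ℂ] H} (hV : OrthogonalFamily ℂ G V) {x : κ → H}
    (hx : Summable fun k => ‖x k‖ ^ 2) :
    Summable fun q : κ × ι => ‖adjoint (V q.2).toContinuousLinearMap (x q.1)‖ ^ 2 := by
  have hs (k : κ) := summable_of_sum_le (fun i => sq_nonneg _) (sum_norm_sq_adjoint_le hV (x k))
  refine (summable_prod_of_nonneg fun q => sq_nonneg _).mpr ⟨hs, ?_⟩
  exact Summable.of_nonneg_of_le (fun k => tsum_nonneg fun i => sq_nonneg _)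
    (fun k => (hs k).tsum_le_of_sum_le (sum_norm_sq_adjoint_le hV (x k))) hx

theorem summable_norm_sq_apply {κ E F : Type*} [NormedAddCommGroup E] [NormedSpace ℂ E]
    [NormedAddCommGroup F] [NormedSpace ℂ F] {v : κ → E} (hv : Summable fun k => ‖v k‖ ^ 2)
    (T : E →L[ℂ] F) : Summable fun k => ‖T (v k)‖ ^ 2 := by
  refine Summable.of_nonneg_of_le (fun _ => sq_nonneg _) (fun k => ?_) (hv.mul_left (‖T‖ ^ 2))
  rw [← mul_pow]
  exact pow_le_pow_left₀ (norm_nonneg _) (T.le_opNorm _) 2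

end HilbertSpace

section PartialTrace

variable {H K κ : Type*} [NormedAddCommGroup H] [InnerProductSpace ℂ H]
  [NormedAddCommGroup K] [InnerProductSpace ℂ K] [CompleteSpace K]
  {u v : κ → HTensor H K} {T : HTensor H K →L[ℂ] HTensor H K}

theorem summable_rankOne_adjoint_ketTensor {ι : Type*} {b : ι → H} (hb : Orthonormal ℂ b)
    (hu : Summable fun k => ‖u k‖ ^ 2) (hv : Summable fun k => ‖v k‖ ^ 2) :
    Summable fun q : κ × ι => (InnerProductSpace.rankOne ℂ
      (adjoint (ketTensor (b q.2)) (u q.1)) (adjoint (ketTensor (b q.2)) (v q.1)) : K →L[ℂ] K) := by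
  have hV : OrthogonalFamily ℂ (fun _ : ι => K) _ := orthogonalFamily_ketTensorIsometry hb
  have hs := (summable_norm_sq_adjoint hV hu).add (summable_norm_sq_adjoint hV hv)
  refine Summable.of_norm_bounded hs fun q => ?_
  simp only [ketTensorIsometry_toContinuousLinearMap, InnerProductSpace.norm_rankOne]
  nlinarith [two_mul_le_add_sq ‖adjoint (ketTensor (K := K) (b q.2)) (u q.1)‖
    ‖adjoint (ketTensor (K := K) (b q.2)) (v q.1)‖,
    norm_nonneg (adjoint (ketTensor (K := K) (b q.2)) (u q.1)),
    norm_nonneg (adjoint (ketTensor (K := K) (b q.2)) (v q.1))]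

variable [CompleteSpace H]

theorem hasSum_partialTrace (hu : Summable fun k => ‖u k‖ ^ 2) (hv : Summable fun k => ‖v k‖ ^ 2)
    (hT : ∀ x, HasSum (fun k => ⟪v k, x⟫_ℂ • u k) (T x)) :
    HasSum (fun q : κ × basisSet H => InnerProductSpace.rankOne ℂ
      (adjoint (ketTensor (someBasis H q.2)) (u q.1))
      (adjoint (ketTensor (someBasis H q.2)) (v q.1))) (partialTrace T) := by
  have hs := summable_rankOne_adjoint_ketTensor (someBasis H).orthonormal hu hv
  convert hs.hasSum
  refine ((hasSum_prod_swap hs.hasSum).prod_fiberwise fun i => ?_).tsum_eq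
  have hrow := hs.comp_injective (Prod.mk_left_injective i)
  suffices heq : adjoint (ketTensor (someBasis H i)) ∘L T ∘L ketTensor (someBasis H i) =
      ∑' k, _ from heq ▸ hrow.hasSum
  refine ContinuousLinearMap.ext fun x =>
    HasSum.unique ?_ (hrow.hasSum.mapL (ContinuousLinearMap.apply ℂ K x))
  convert (hT (ketTensor (someBasis H i) x)).mapL
    (adjoint (ketTensor (K := K) (someBasis H i))) using 2 with k
  · simp [adjoint_inner_left]
  · rfl

theorem hasSum_inner_partialTrace (hu : Summable fun k => ‖u k‖ ^ 2)
    (hv : Summable fun k => ‖v k‖ ^ 2) (hT : ∀ x, HasSum (fun k => ⟪v k, x⟫_ℂ • u k) (T x))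
    (e f : K) :
    HasSum (fun k => ⟪adjoint (tensorKet f) (v k), adjoint (tensorKet e) (u k)⟫_ℂ)
      ⟪e, partialTrace T f⟫_ℂ := by
  have h := ((hasSum_partialTrace hu hv hT).mapL (ContinuousLinearMap.apply ℂ K f)).mapL
    (innerSL ℂ e)
  refine h.prod_fiberwise fun k => ?_
  convert (someBasis H).hasSum_inner_mul_inner (adjoint (tensorKet f) (v k))
    (adjoint (tensorKet e) (u k)) using 2 with i
  dsimp only
  rw [apply_apply, innerSL_apply_apply, InnerProductSpace.rankOne_apply, inner_smul_right,
    inner_adjoint_ketTensor, ← inner_conj_symm, inner_adjoint_ketTensor, inner_conj_symm]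

theorem norm_partialTrace_le (hu : Summable fun k => ‖u k‖ ^ 2)
    (hv : Summable fun k => ‖v k‖ ^ 2) (hT : ∀ x, HasSum (fun k => ⟪v k, x⟫_ℂ • u k) (T x))
    {c : ℝ} (hc : HasSum (fun k => ‖v k‖ * ‖u k‖) c) : ‖partialTrace T‖ ≤ c := by
  refine opNorm_le_of_re_inner_le (hc.nonneg fun k => by positivity) fun f e hf he => ?_
  have hbound (k : κ) : ‖⟪adjoint (tensorKet f) (v k), adjoint (tensorKet e) (u k)⟫_ℂ‖ ≤
      ‖v k‖ * ‖u k‖ := by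
    have hfv := norm_adjoint_tensorKet_apply_le f (v k)
    have heu := norm_adjoint_tensorKet_apply_le e (u k)
    rw [hf, one_mul] at hfv
    rw [he, one_mul] at heu
    exact (norm_inner_le_norm _ _).trans (by gcongr)
  rw [inner_re_symm, ← (hasSum_inner_partialTrace hu hv hT e f).tsum_eq]
  exact (Complex.re_le_norm _).trans (tsum_of_norm_bounded hc hbound)

theorem partialTrace_smul (c : ℂ) (T : HTensor H K →L[ℂ] HTensor H K) :
    partialTrace (c • T) = c • partialTrace T := by
  simp only [partialTrace, smul_comp, comp_smul, tsum_const_smul'']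

end PartialTrace

section Ensemble

variable {H H' K κ : Type*} [NormedAddCommGroup H] [InnerProductSpace ℂ H]
  [NormedAddCommGroup H'] [InnerProductSpace ℂ H']
  [NormedAddCommGroup K] [InnerProductSpace ℂ K]

/-- `ρ = ∑ₖ |vₖ⟩⟨vₖ|` pointwise, and the weights `‖vₖ‖²` of the vectors add up to `w`. This exhibits
`ρ` as a positive operator of trace `w`. -/
structure IsEnsemble (v : κ → H) (w : ℝ) (ρ : H →L[ℂ] H) : Prop where
  hasSum_norm_sq : HasSum (fun k => ‖v k‖ ^ 2) w
  hasSum_apply : ∀ x, HasSum (fun k => ⟪v k, x⟫_ℂ • v k) (ρ x)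

theorem IsDensity.exists_isEnsemble [CompleteSpace H] {ρ : H →L[ℂ] H} (hρ : IsDensity ρ) :
    ∃ v : basisSet H → H, IsEnsemble v 1 ρ := by
  set R : H →L[ℂ] H := CFC.sqrt ρ
  have hsa : adjoint R = R := (CFC.sqrt_nonneg ρ).isSelfAdjoint
  have hR (x : H) : R (R x) = ρ x :=
    DFunLike.congr_fun (CFC.sqrt_mul_sqrt_self ρ ((nonneg_iff_isPositive ρ).mpr hρ.1)) x
  refine ⟨fun k => R (someBasis H k), ?_, fun x => ?_⟩
  · rw [← Complex.hasSum_ofReal, Complex.ofReal_one]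
    convert hρ.2 _ (someBasis H) using 2 with k
    rw [← inner_self_eq_ofReal, ← adjoint_inner_right, hsa, hR]
  · rw [← hR]
    convert ((someBasis H).hasSum_repr (R x)).mapL R using 2 with k
    rw [map_smul, HilbertBasis.repr_apply_apply, ← adjoint_inner_left, hsa]

namespace IsEnsemble

variable {v : κ → H} {w : ℝ} {ρ : H →L[ℂ] H}

theorem nonneg (h : IsEnsemble v w ρ) : 0 ≤ w := h.hasSum_norm_sq.nonneg fun _ => sq_nonneg _

theorem hasSum_inner (h : IsEnsemble v w ρ) (x : H) :
    HasSum (fun k => ((‖⟪x, v k⟫_ℂ‖ ^ 2 : ℝ) : ℂ)) ⟪x, ρ x⟫_ℂ := by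
  simpa only [innerSL_apply_apply, inner_smul_right, inner_mul_inner_swap] using
    (h.hasSum_apply x).mapL (innerSL ℂ x)

theorem isPositive (h : IsEnsemble v w ρ) : ρ.IsPositive := by
  refine (isPositive_iff_complex ρ).mpr fun x => ?_
  have hre : HasSum (fun k => ‖⟪x, v k⟫_ℂ‖ ^ 2) (⟪x, ρ x⟫_ℂ).re :=
    (h.hasSum_inner x).mapL Complex.reCLM
  have heq : ⟪x, ρ x⟫_ℂ = ((⟪x, ρ x⟫_ℂ).re : ℂ) :=
    (h.hasSum_inner x).unique (Complex.hasSum_ofReal.mpr hre)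
  rw [← inner_conj_symm, heq]
  simpa using hre.nonneg fun k => sq_nonneg _

theorem hasSum_trace (h : IsEnsemble v w ρ) {ι : Type*} (b : HilbertBasis ι ℂ H) :
    HasSum (fun i => ⟪b i, ρ (b i)⟫_ℂ) (w : ℂ) := by
  have hprod : HasSum (fun q : κ × ι => ‖⟪b q.2, v q.1⟫_ℂ‖ ^ 2) w := by
    refine hasSum_prod_of_nonneg (fun _ => sq_nonneg _) (fun k => ?_) h.hasSum_norm_sq
    rw [← Complex.hasSum_ofReal, ← inner_self_eq_ofReal]
    simpa only [inner_mul_inner_swap] using b.hasSum_inner_mul_inner (v k) (v k)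
  exact (hasSum_prod_swap (Complex.hasSum_ofReal.mpr hprod)).prod_fiberwise
    fun i => h.hasSum_inner (b i)

theorem isDensity_inv_smul (h : IsEnsemble v w ρ) (hw : w ≠ 0) :
    IsDensity ((w : ℂ)⁻¹ • ρ) := by
  have hinv : 0 ≤ w⁻¹ := inv_nonneg.mpr h.nonneg
  refine ⟨h.isPositive.smul_of_nonneg (by exact_mod_cast hinv), fun s b => ?_⟩
  simpa [inner_smul_right, hw] using (h.hasSum_trace b).mul_left (w : ℂ)⁻¹

variable [CompleteSpace H] [CompleteSpace H']

theorem conj (h : IsEnsemble v w ρ) (T : H →L[ℂ] H') :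
    IsEnsemble (fun k => T (v k)) (∑' k, ‖T (v k)‖ ^ 2) (T ∘L ρ ∘L adjoint T) where
  hasSum_norm_sq := (summable_norm_sq_apply h.hasSum_norm_sq.summable T).hasSum
  hasSum_apply x := by
    simpa only [map_smul, adjoint_inner_right, comp_apply] using
      (h.hasSum_apply (adjoint T x)).mapL T

end IsEnsemble

section PartialTrace

variable {v : κ → HTensor H K} {w : ℝ}
  {ρ : HTensor H K →L[ℂ] HTensor H K}

theorem IsEnsemble.hasSum_tensorMap_one_apply (h : IsEnsemble v w ρ) (A : H →L[ℂ] H)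
    (x : HTensor H K) :
    HasSum (fun k => ⟪v k, x⟫_ℂ • tensorMap A (1 : K →L[ℂ] K) (v k))
      ((tensorMap A (1 : K →L[ℂ] K) * ρ) x) := by
  simpa only [map_smul, mul_def, comp_apply] using
    (h.hasSum_apply x).mapL (tensorMap A (1 : K →L[ℂ] K))

variable [CompleteSpace H] [CompleteSpace K]

theorem IsEnsemble.hasSum_inner_partialTrace_mul (h : IsEnsemble v w ρ) (A : H →L[ℂ] H) (e : K) :
    HasSum (fun k => ⟪adjoint (tensorKet e) (v k), A (adjoint (tensorKet e) (v k))⟫_ℂ)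
      ⟪e, partialTrace (tensorMap A (1 : K →L[ℂ] K) * ρ) e⟫_ℂ := by
  have hv := h.hasSum_norm_sq.summable
  simpa only [adjoint_tensorKet_tensorMap_one] using hasSum_inner_partialTrace
    (summable_norm_sq_apply hv _) hv (h.hasSum_tensorMap_one_apply A) e e

theorem IsEnsemble.norm_partialTrace_mul_le (h : IsEnsemble v w ρ) (A : H →L[ℂ] H) :
    ‖partialTrace (tensorMap A (1 : K →L[ℂ] K) * ρ)‖ ≤ ‖A‖ * w := by
  have hv := h.hasSum_norm_sq
  have hle (k : κ) : ‖v k‖ * ‖tensorMap A (1 : K →L[ℂ] K) (v k)‖ ≤ ‖A‖ * ‖v k‖ ^ 2 := by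
    calc ‖v k‖ * ‖tensorMap A (1 : K →L[ℂ] K) (v k)‖ ≤ ‖v k‖ * (‖A‖ * ‖v k‖) := by
          gcongr; exact le_of_opNorm_le _ (norm_tensorMap_one_le A) _
      _ = ‖A‖ * ‖v k‖ ^ 2 := by ring
  have hs : Summable fun k => ‖v k‖ * ‖tensorMap A (1 : K →L[ℂ] K) (v k)‖ :=
    Summable.of_nonneg_of_le (fun _ => by positivity) hle (hv.summable.mul_left _)
  exact (norm_partialTrace_le (summable_norm_sq_apply hv.summable _) hv.summable
    (h.hasSum_tensorMap_one_apply A) hs.hasSum).trans (hasSum_le hle hs.hasSum (hv.mul_left _))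

end PartialTrace

end Ensemble

section WeakSum

theorem hasSum_mul_prod {ι κ : Type*} {f : ι → ℂ} {g : κ → ℂ} {a b : ℂ} (hf : HasSum f a)
    (hg : HasSum g b) : HasSum (fun l : ι × κ => f l.1 * g l.2) (a * b) :=
  hf.mul hg (summable_mul_of_summable_norm hf.summable.norm hg.summable.norm)

theorem hasSum_apply_of_dense {ι E F : Type*} {σ : ℂ →+* ℂ} [RingHomIsometric σ]
    [NormedAddCommGroup E] [NormedSpace ℂ E] [NormedAddCommGroup F] [NormedSpace ℂ F]
    {φ : ι → E →SL[σ] F} {ψ : E →SL[σ] F} {D : Set E} (hD : Dense D) {c : ℝ}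
    (hc : ∀ s : Finset ι, ‖∑ i ∈ s, φ i‖ ≤ c) (h : ∀ x ∈ D, HasSum (fun i => φ i x) (ψ x))
    (x : E) : HasSum (fun i => φ i x) (ψ x) := by
  have hE : UniformEquicontinuous fun (s : Finset ι) (x : E) => ∑ i ∈ s, φ i x := by
    refine LipschitzWith.uniformEquicontinuous _ c.toNNReal fun s => ?_
    refine LipschitzWith.of_dist_le' fun x y => ?_
    simp only [dist_eq_norm, ← sum_apply, ← map_sub]
    exact le_of_opNorm_le _ (hc s) _
  exact (hE.equicontinuous x).tendsto_of_mem_closure (ψ.continuous.continuousAt.mono_left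
    inf_le_left) h (hD x)

variable {H H' K K' ι κ : Type*} [NormedAddCommGroup H] [InnerProductSpace ℂ H]
  [NormedAddCommGroup H'] [InnerProductSpace ℂ H']
  [NormedAddCommGroup K] [InnerProductSpace ℂ K]

/-- The series `∑ᵢ Bᵢ` of operators converges unconditionally to `A` in the weak operator
topology. -/
def HasWeakSum (B : ι → H →L[ℂ] H) (A : H →L[ℂ] H) : Prop :=
  ∀ x y, HasSum (fun i => ⟪x, B i y⟫_ℂ) ⟪x, A y⟫_ℂ

theorem hasWeakSum_of_dense {B : ι → H →L[ℂ] H} {A : H →L[ℂ] H} {D : Set H} (hD : Dense D) {c : ℝ}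
    (hc : ∀ s : Finset ι, ‖∑ i ∈ s, B i‖ ≤ c)
    (h : ∀ x ∈ D, ∀ y ∈ D, HasSum (fun i => ⟪x, B i y⟫_ℂ) ⟪x, A y⟫_ℂ) : HasWeakSum B A := by
  have hright (x : H) (hx : x ∈ D) (y : H) : HasSum (fun i => ⟪x, B i y⟫_ℂ) ⟪x, A y⟫_ℂ := by
    refine hasSum_apply_of_dense (φ := fun i => innerSL ℂ x ∘L B i) (ψ := innerSL ℂ x ∘L A)
      (c := ‖innerSL ℂ x‖ * c) hD (fun s => ?_) (h x hx) y
    rw [← comp_finsetSum]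
    exact (opNorm_comp_le _ _).trans (by gcongr; exact hc s)
  intro x y
  refine hasSum_apply_of_dense (φ := fun i => innerSLFlip ℂ (B i y)) (ψ := innerSLFlip ℂ (A y))
    (c := ‖innerSLFlip (E := H) ℂ‖ * (c * ‖y‖)) hD (fun s => ?_) (fun x hx => hright x hx y) x
  rw [← map_sum, ← sum_apply]
  exact (le_opNorm _ _).trans (by gcongr; exact le_of_opNorm_le _ (hc s) y)

open scoped ComplexOrder in
theorem isPositive_of_dense {A : H →L[ℂ] H} {D : Set H} (hD : Dense D)
    (h : ∀ x ∈ D, 0 ≤ ⟪x, A x⟫_ℂ) : A.IsPositive := by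
  have hclosed : IsClosed {x | 0 ≤ ⟪x, A x⟫_ℂ} := isClosed_le (by fun_prop) (by fun_prop)
  refine (isPositive_iff_complex A).mpr fun x => ?_
  have hx : 0 ≤ ⟪A x, x⟫_ℂ := by
    rw [← inner_conj_symm]
    exact star_nonneg_iff.mpr (closure_minimal h hclosed (hD x))
  obtain ⟨hre, him⟩ := Complex.nonneg_iff.mp hx
  exact ⟨Complex.ext rfl him, hre⟩

open scoped ComplexOrder in
theorem hasWeakSum_of_isPositive_of_dense [CompleteSpace H] {B : ι → H →L[ℂ] H} {A : H →L[ℂ] H}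
    {D : Set H} (hD : Dense D) (hB : ∀ i, (B i).IsPositive)
    (h : ∀ x ∈ D, ∀ y ∈ D, HasSum (fun i => ⟪x, B i y⟫_ℂ) ⟪x, A y⟫_ℂ) : HasWeakSum B A := by
  refine hasWeakSum_of_dense hD (c := ‖A‖) (fun s => ?_) h
  refine CStarAlgebra.norm_le_norm_of_nonneg_of_le
    ((nonneg_iff_isPositive _).mpr (isPositive_sum _ fun i _ => hB i)) ?_
  refine (le_def _ _).mpr (isPositive_of_dense hD fun x hx => ?_)
  rw [sub_apply, inner_sub_right, sum_apply, inner_sum, sub_nonneg]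
  exact sum_le_hasSum s (fun i _ => (hB i).inner_nonneg_right x) (h x hx x hx)

theorem hasSum_inner_tensorMap_coe {B : ι → H →L[ℂ] H} {A : H →L[ℂ] H} {B' : κ → K →L[ℂ] K}
    {A' : K →L[ℂ] K} (h : HasWeakSum B A) (h' : HasWeakSum B' A') (x y : H ⊗[ℂ] K) :
    HasSum (fun l : ι × κ => ⟪(x : HTensor H K), tensorMap (B l.1) (B' l.2) y⟫_ℂ)
      ⟪(x : HTensor H K), tensorMap A A' y⟫_ℂ := by
  induction x using TensorProduct.induction_on with
  | zero => simp [UniformSpace.Completion.coe_zero]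
  | add x x' hx hx' => simpa [UniformSpace.Completion.coe_add, inner_add_left] using hx.add hx'
  | tmul u v =>
    induction y using TensorProduct.induction_on with
    | zero => simp [UniformSpace.Completion.coe_zero]
    | add y y' hy hy' => simpa [UniformSpace.Completion.coe_add, inner_add_right] using hy.add hy'
    | tmul u' v' =>
      simp only [← ketTensor_apply, tensorMap_ketTensor, inner_ketTensor]
      have hmul := hasSum_mul_prod (h u u') (h' v v')
      exact hmul

variable [CompleteSpace H] [CompleteSpace K]

theorem HasWeakSum.tensor {B : ι → H →L[ℂ] H} {A : H →L[ℂ] H} {B' : κ → K →L[ℂ] K}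
    {A' : K →L[ℂ] K} (h : HasWeakSum B A) (h' : HasWeakSum B' A') (hB : ∀ i, (B i).IsPositive)
    (hB' : ∀ j, (B' j).IsPositive) :
    HasWeakSum (fun l : ι × κ => tensorMap (B l.1) (B' l.2)) (tensorMap A A') := by
  refine hasWeakSum_of_isPositive_of_dense
    (UniformSpace.Completion.denseRange_coe (α := H ⊗[ℂ] K))
    (fun l => isPositive_tensorMap (hB l.1) (hB' l.2)) ?_
  rintro _ ⟨x, rfl⟩ _ ⟨y, rfl⟩
  exact hasSum_inner_tensorMap_coe h h' x y

theorem HasWeakSum.tensor_one {B : ι → H →L[ℂ] H} {A : H →L[ℂ] H} (h : HasWeakSum B A)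
    (hB : ∀ i, (B i).IsPositive) :
    HasWeakSum (fun i => tensorMap (B i) (1 : K →L[ℂ] K))
      (tensorMap A 1) := fun x y =>
  have hone : HasWeakSum (fun _ : Unit => (1 : K →L[ℂ] K)) 1 := fun _ _ => hasSum_unique _
  (Equiv.prodPUnit ι).hasSum_iff.mp (h.tensor hone hB (fun _ => isPositive_one) x y)

theorem hasSum_norm_sq_tensorMap_one [CompleteSpace H'] {C : ι → H →L[ℂ] H'}
    (hC : HasWeakSum (fun i => adjoint (C i) ∘L C i) 1) (x : HTensor H K) :
    HasSum (fun i => ‖tensorMap (C i) (1 : K →L[ℂ] K) x‖ ^ 2) (‖x‖ ^ 2) := by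
  have h := hC.tensor_one (K := K) (fun i => isPositive_adjoint_comp_self (C i)) x x
  have hadj (i : ι) : tensorMap (adjoint (C i) ∘L C i) (1 : K →L[ℂ] K) =
      adjoint (tensorMap (C i) (1 : K →L[ℂ] K)) ∘L tensorMap (C i) 1 := by
    rw [adjoint_tensorMap, ← tensorMap_comp, adjoint_one]; rfl
  rw [← Complex.hasSum_ofReal]
  simpa only [hadj, comp_apply, adjoint_inner_right, inner_self_eq_ofReal, tensorMap_one_one,
    one_apply_eq_self] using h

end WeakSum

section Compression

open scoped ComplexOrder in
theorem hasSum_prod_of_complex_nonneg {α β : Type*} {f : α × β → ℂ} {g : α → ℂ} {c : ℂ}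
    (hf : ∀ p, 0 ≤ f p) (hfg : ∀ a, HasSum (fun b => f (a, b)) (g a)) (hg : HasSum g c) :
    HasSum f c := by
  have hre : HasSum (fun p => (f p).re) c.re :=
    hasSum_prod_of_nonneg (fun p => (Complex.nonneg_iff.mp (hf p)).1)
      (fun a => (hfg a).mapL Complex.reCLM) (hg.mapL Complex.reCLM)
  have hs : Summable f := by
    convert (Complex.hasSum_ofReal.mpr hre).summable using 2 with p
    exact Complex.ext rfl (Complex.nonneg_iff.mp (hf p)).2.symm
  rw [hg.unique (hs.hasSum.prod_fiberwise hfg)]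
  exact hs.hasSum

variable {H H' K : Type*} [NormedAddCommGroup H] [InnerProductSpace ℂ H]
  [NormedAddCommGroup H'] [InnerProductSpace ℂ H']
  [NormedAddCommGroup K] [InnerProductSpace ℂ K]
  {ι κ : Type*} {v : κ → HTensor H K} {w : ℝ} {ρ : HTensor H K →L[ℂ] HTensor H K}

/-- The operator `(C ⊗ 1) ρ (C ⊗ 1)†`, the state `ρ` compressed along an operator `C` on the first
factor. -/
def compress (C : H →L[ℂ] H') (ρ : HTensor H K →L[ℂ] HTensor H K) :
    HTensor H' K →L[ℂ] HTensor H' K :=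
  tensorMap C 1 ∘L ρ ∘L adjoint (tensorMap C 1)

theorem IsEnsemble.isEnsemble_compress (h : IsEnsemble v w ρ) (C : H →L[ℂ] H') :
    IsEnsemble (fun k => tensorMap C (1 : K →L[ℂ] K) (v k))
      (∑' k, ‖tensorMap C (1 : K →L[ℂ] K) (v k)‖ ^ 2) (compress C ρ) :=
  h.conj (tensorMap C 1)

variable [CompleteSpace H] [CompleteSpace H'] [CompleteSpace K]

theorem IsEnsemble.hasSum_weight_compress (h : IsEnsemble v w ρ) {C : ι → H →L[ℂ] H'}
    (hC : HasWeakSum (fun i => adjoint (C i) ∘L C i) 1) :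
    HasSum (fun i => ∑' k, ‖tensorMap (C i) (1 : K →L[ℂ] K) (v k)‖ ^ 2) w := by
  have hprod : HasSum (fun q : κ × ι => ‖tensorMap (C q.2) (1 : K →L[ℂ] K) (v q.1)‖ ^ 2) w :=
    hasSum_prod_of_nonneg (fun _ => sq_nonneg _) (fun k => hasSum_norm_sq_tensorMap_one hC (v k))
      h.hasSum_norm_sq
  exact (hasSum_prod_swap hprod).prod_fiberwise fun i =>
    (h.isEnsemble_compress (C i)).hasSum_norm_sq

theorem IsEnsemble.hasSum_inner_partialTrace_compress (h : IsEnsemble v w ρ)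
    {C : ι → H →L[ℂ] H'} {Q : ι → H' →L[ℂ] H'} {A : H →L[ℂ] H} (hQ : ∀ i, (Q i).IsPositive)
    (hA : HasWeakSum (fun i => adjoint (C i) ∘L Q i ∘L C i) A) (e : K) :
    HasSum (fun i => ⟪e, partialTrace (tensorMap (Q i) (1 : K →L[ℂ] K) * compress (C i) ρ) e⟫_ℂ)
      ⟪e, partialTrace (tensorMap A (1 : K →L[ℂ] K) * ρ) e⟫_ℂ := by
  set z : κ → H := fun k => adjoint (tensorKet e) (v k) with hz
  have hprod : HasSum (fun q : κ × ι => ⟪z q.1, (adjoint (C q.2) ∘L Q q.2 ∘L C q.2) (z q.1)⟫_ℂ)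
      ⟪e, partialTrace (tensorMap A (1 : K →L[ℂ] K) * ρ) e⟫_ℂ :=
    hasSum_prod_of_complex_nonneg
      (fun q => ((hQ q.2).adjoint_conj (C q.2)).inner_nonneg_right (z q.1))
      (fun k => hA (z k) (z k)) (h.hasSum_inner_partialTrace_mul A e)
  refine (hasSum_prod_swap hprod).prod_fiberwise fun i => ?_
  simpa only [adjoint_tensorKet_tensorMap_one, comp_apply, adjoint_inner_right, hz,
    Prod.swap_prod_mk] using
    (h.isEnsemble_compress (C i)).hasSum_inner_partialTrace_mul (Q i) e

theorem IsEnsemble.hasSum_partialTrace_compress (h : IsEnsemble v w ρ) {C : ι → H →L[ℂ] H'}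
    {Q : ι → H' →L[ℂ] H'} {A : H →L[ℂ] H} (hC : HasWeakSum (fun i => adjoint (C i) ∘L C i) 1)
    (hQ : ∀ i, (Q i).IsPositive) (hQ_le : ∀ i, ‖Q i‖ ≤ 1)
    (hA : HasWeakSum (fun i => adjoint (C i) ∘L Q i ∘L C i) A) :
    HasSum (fun i => partialTrace (tensorMap (Q i) (1 : K →L[ℂ] K) * compress (C i) ρ))
      (partialTrace (tensorMap A (1 : K →L[ℂ] K) * ρ)) := by
  have hs : Summable fun i =>
      partialTrace (tensorMap (Q i) (1 : K →L[ℂ] K) * compress (C i) ρ) := by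
    refine Summable.of_norm_bounded (h.hasSum_weight_compress hC).summable fun i => ?_
    have hi := h.isEnsemble_compress (C i)
    exact (hi.norm_partialTrace_mul_le (Q i)).trans (mul_le_of_le_one_left hi.nonneg (hQ_le i))
  convert hs.hasSum
  refine ContinuousLinearMap.coe_injective ((ext_inner_map _ _).mp fun e => ?_)
  have hflip := (h.hasSum_inner_partialTrace_compress hQ hA e).unique
    ((hs.hasSum.mapL (ContinuousLinearMap.apply ℂ K e)).mapL (innerSL ℂ e))
  simpa only [innerSL_apply_apply, apply_apply, inner_conj_symm, coe_coe] using
    congrArg (starRingEnd ℂ) hflip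

theorem IsEnsemble.exists_isDensity_smul_partialTrace_eq (h : IsEnsemble v w ρ)
    (hd : ∃ σ : HTensor H K →L[ℂ] HTensor H K, IsDensity σ) :
    ∃ σ : HTensor H K →L[ℂ] HTensor H K, IsDensity σ ∧ ∀ A : H →L[ℂ] H,
      (w : ℂ) • partialTrace (tensorMap A (1 : K →L[ℂ] K) * σ) =
        partialTrace (tensorMap A (1 : K →L[ℂ] K) * ρ) := by
  obtain rfl | hw := eq_or_ne w 0
  · obtain ⟨σ, hσ⟩ := hd
    refine ⟨σ, hσ, fun A => ?_⟩
    have hzero := h.norm_partialTrace_mul_le A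
    rw [mul_zero, norm_le_zero_iff] at hzero
    rw [hzero, Complex.ofReal_zero, zero_smul]
  · refine ⟨(w : ℂ)⁻¹ • ρ, h.isDensity_inv_smul hw, fun A => ?_⟩
    rw [mul_smul_comm, partialTrace_smul, smul_inv_smul₀ (by exact_mod_cast hw)]

theorem IsEnsemble.exists_isDensity_compress (h : IsEnsemble v 1 ρ) {C : ι → H →L[ℂ] H'}
    (hC : HasWeakSum (fun i => adjoint (C i) ∘L C i) 1) :
    ∃ (w : ι → ℝ) (σ : ι → HTensor H' K →L[ℂ] HTensor H' K),
      (∀ i, 0 ≤ w i) ∧ HasSum w 1 ∧ (∀ i, IsDensity (σ i)) ∧ ∀ (i : ι) (A : H' →L[ℂ] H'),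
        (w i : ℂ) • partialTrace (tensorMap A (1 : K →L[ℂ] K) * σ i) =
          partialTrace (tensorMap A (1 : K →L[ℂ] K) * compress (C i) ρ) := by
  have hw := h.hasSum_weight_compress hC
  obtain ⟨i₀, hi₀⟩ : ∃ i, ∑' k, ‖tensorMap (C i) (1 : K →L[ℂ] K) (v k)‖ ^ 2 ≠ 0 := by
    by_contra! hzero
    exact zero_ne_one (hasSum_zero.unique (by simpa only [hzero] using hw))
  choose σ hσ using fun i => (h.isEnsemble_compress (C i)).exists_isDensity_smul_partialTrace_eq
    ⟨_, (h.isEnsemble_compress (C i₀)).isDensity_inv_smul hi₀⟩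
  exact ⟨_, σ, fun i => (h.isEnsemble_compress (C i)).nonneg, hw, fun i => (hσ i).1,
    fun i => (hσ i).2⟩

end Compression

section CStarCombination

variable {H : Type*} [NormedAddCommGroup H] [InnerProductSpace ℂ H]
  {K : Type*} [NormedAddCommGroup K] [InnerProductSpace ℂ K] {A B : Type*} [Fintype A] [Fintype B]

/-- A positive operator valued measure with the finite outcome set `A`. -/
structure IsPOVM (M : A → H →L[ℂ] H) : Prop where
  isPositive : ∀ a, (M a).IsPositive
  sum_eq_one : ∑ a, M a = 1

theorem IsPOVM.norm_le_one [CompleteSpace H] {M : A → H →L[ℂ] H} (h : IsPOVM M) (a : A) :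
    ‖M a‖ ≤ 1 := by
  have hnonneg (b : A) : 0 ≤ M b := (nonneg_iff_isPositive _).mpr (h.isPositive b)
  rw [CStarAlgebra.norm_le_one_iff_of_nonneg _ (hnonneg a), ← h.sum_eq_one]
  exact Finset.single_le_sum (fun b _ => hnonneg b) (Finset.mem_univ a)

theorem IsPOVM.tensor [CompleteSpace H] [CompleteSpace K] {M : A → H →L[ℂ] H} {N : B → K →L[ℂ] K}
    (h : IsPOVM M) (h' : IsPOVM N) : IsPOVM fun c : A × B => tensorMap (M c.1) (N c.2) where
  isPositive c := isPositive_tensorMap (h.isPositive c.1) (h'.isPositive c.2)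
  sum_eq_one := by
    rw [← tensorMap_sum_sum, h.sum_eq_one, h'.sum_eq_one, tensorMap_one_one]

variable [CompleteSpace H] [CompleteSpace K]
  {H' : Type*} [NormedAddCommGroup H'] [InnerProductSpace ℂ H'] [CompleteSpace H']
  {K' : Type*} [NormedAddCommGroup K'] [InnerProductSpace ℂ K'] [CompleteSpace K'] {X Y ι κ : Type*}

/-- The POVMs `M x` are the C⋆-convex combination `M_{a|x} = ∑ᵢ Cᵢ† Q_{i,a|x} Cᵢ` of the POVMs
`Q i x`, the series converging in the weak operator topology. Summing over the outcomes `a` yields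
the normalization `∑ᵢ Cᵢ† Cᵢ = 1`. -/
structure IsCStarCombination (M : X → A → H →L[ℂ] H) (C : ι → H →L[ℂ] H')
    (Q : ι → X → A → H' →L[ℂ] H') : Prop where
  isPOVM : ∀ i x, IsPOVM (Q i x)
  hasWeakSum : ∀ x a, HasWeakSum (fun i => adjoint (C i) ∘L Q i x a ∘L C i) (M x a)

namespace IsCStarCombination

variable {M : X → A → H →L[ℂ] H} {C : ι → H →L[ℂ] H'} {Q : ι → X → A → H' →L[ℂ] H'}

theorem hasWeakSum_adjoint_comp_self (h : IsCStarCombination M C Q) {x : X} (hM : ∑ a, M x a = 1) :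
    HasWeakSum (fun i => adjoint (C i) ∘L C i) 1 := fun u v => by
  have hsum := hasSum_sum fun a (_ : a ∈ Finset.univ) => h.hasWeakSum x a u v
  simpa only [comp_apply, adjoint_inner_right, ← inner_sum, ← sum_apply, hM,
    (h.isPOVM _ x).sum_eq_one, one_apply_eq_self] using hsum

theorem tensor {N : Y → B → K →L[ℂ] K} {C' : κ → K →L[ℂ] K'} {Q' : κ → Y → B → K' →L[ℂ] K'}
    (h : IsCStarCombination M C Q) (h' : IsCStarCombination N C' Q') :
    IsCStarCombination (fun (x : X × Y) (a : A × B) => tensorMap (M x.1 a.1) (N x.2 a.2))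
      (fun l : ι × κ => tensorMap (C l.1) (C' l.2))
      (fun l x a => tensorMap (Q l.1 x.1 a.1) (Q' l.2 x.2 a.2)) where
  isPOVM l x := (h.isPOVM l.1 x.1).tensor (h'.isPOVM l.2 x.2)
  hasWeakSum x a := by
    simpa only [tensorMap_adjoint_conj] using (h.hasWeakSum x.1 a.1).tensor (h'.hasWeakSum x.2 a.2)
      (fun i => ((h.isPOVM i x.1).isPositive a.1).adjoint_conj (C i))
      (fun j => ((h'.isPOVM j x.2).isPositive a.2).adjoint_conj (C' j))

theorem exists_hasSum_smul_partialTrace (h : IsCStarCombination M C Q) {x₀ : X}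
    (hM : ∑ a, M x₀ a = 1) {ρ : HTensor H K →L[ℂ] HTensor H K} (hρ : IsDensity ρ) :
    ∃ (w : ι → ℝ) (σ : ι → HTensor H' K →L[ℂ] HTensor H' K),
      (∀ i, 0 ≤ w i) ∧ HasSum w 1 ∧ (∀ i, IsDensity (σ i)) ∧ ∀ x a,
        HasSum (fun i => (w i : ℂ) • partialTrace (tensorMap (Q i x a) (1 : K →L[ℂ] K) * σ i))
          (partialTrace (tensorMap (M x a) (1 : K →L[ℂ] K) * ρ)) := by
  obtain ⟨v, hv⟩ := hρ.exists_isEnsemble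
  have hC := h.hasWeakSum_adjoint_comp_self hM
  obtain ⟨w, σ, hw, hw_sum, hσ, hwσ⟩ := hv.exists_isDensity_compress hC
  refine ⟨w, σ, hw, hw_sum, hσ, fun x a => ?_⟩
  simpa only [hwσ] using hv.hasSum_partialTrace_compress hC
    (fun i => (h.isPOVM i x).isPositive a) (fun i => (h.isPOVM i x).norm_le_one a)
    (h.hasWeakSum x a)

end IsCStarCombination

end CStarCombination

section PostMeasurement

variable {HA HB HE : Type*} [NormedAddCommGroup HA] [InnerProductSpace ℂ HA]
  [NormedAddCommGroup HB] [InnerProductSpace ℂ HB] [NormedAddCommGroup HE] [InnerProductSpace ℂ HE]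

theorem MeasurementStrategy.isPOVM_M (S : MeasurementStrategy HA HB) (x : Fin 2) :
    IsPOVM (S.M x) :=
  ⟨S.M_pos x, S.M_sum x⟩

theorem MeasurementStrategy.isPOVM_N (S : MeasurementStrategy HA HB) (y : Fin 2) :
    IsPOVM (S.N y) :=
  ⟨S.N_pos y, S.N_sum y⟩

theorem smul_smul_opTensor (c d : ℂ) (R : HA →L[ℂ] HA) (T : HE →L[ℂ] HE) :
    c • d • opTensor R T = d • opTensor R (c • T) := by
  rw [smul_comm, opTensor_eq_tensorMap, opTensor_eq_tensorMap, ← tensorMapRight_apply,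
    ← tensorMapRight_apply, map_smul]

variable [CompleteSpace HE] {ι κ : Type*}

theorem hasSum_smul_postMeasurement {S : MeasurementStrategy HA HB}
    {ρ : HTensor (HTensor HA HB) HE →L[ℂ] HTensor (HTensor HA HB) HE} (p : Fin 2 × Fin 2 → ℝ)
    {T : ι → MeasurementStrategy Qubit Qubit} {w : ι → ℂ}
    {σ : ι → HTensor (HTensor Qubit Qubit) HE →L[ℂ] HTensor (HTensor Qubit Qubit) HE}
    (h : ∀ a b x y, HasSum (fun l => w l • partialTrace
        (tensorMap (tensorMap ((T l).M x a) ((T l).N y b)) (1 : HE →L[ℂ] HE) * σ l))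
      (partialTrace (tensorMap (tensorMap (S.M x a) (S.N y b)) (1 : HE →L[ℂ] HE) * ρ))) :
    HasSum (fun l => w l • (T l).postMeasurement p (σ l)) (S.postMeasurement p ρ) := by
  simp only [MeasurementStrategy.postMeasurement, Finset.smul_sum, smul_smul_opTensor]
  exact hasSum_sum fun a _ => hasSum_sum fun b _ => hasSum_sum fun x _ => hasSum_sum fun y _ =>
    ((h a b x y).mapL (tensorMapRight _)).const_smul _

theorem MeasurementStrategy.isQubitMixture [CompleteSpace HA] [CompleteSpace HB]
    (S : MeasurementStrategy HA HB)
    {C : ι → HA →L[ℂ] Qubit} {Q : ι → Fin 2 → Fin 2 → Qubit →L[ℂ] Qubit}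
    {C' : κ → HB →L[ℂ] Qubit} {Q' : κ → Fin 2 → Fin 2 → Qubit →L[ℂ] Qubit}
    (h : IsCStarCombination S.M C Q) (h' : IsCStarCombination S.N C' Q')
    (p : Fin 2 × Fin 2 → ℝ) {ρ : HTensor (HTensor HA HB) HE →L[ℂ] HTensor (HTensor HA HB) HE}
    (hρ : IsDensity ρ) : IsQubitMixture (ι × κ) p (S.postMeasurement p ρ) := by
  obtain ⟨w, σ, hw, hw_sum, hσ, hsum⟩ :=
    (h.tensor h').exists_hasSum_smul_partialTrace (x₀ := (0, 0))
    ((S.isPOVM_M 0).tensor (S.isPOVM_N 0)).sum_eq_one hρ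
  exact ⟨w, fun l => ⟨Q l.1, Q' l.2, fun x => (h.isPOVM l.1 x).isPositive,
    fun x => (h.isPOVM l.1 x).sum_eq_one, fun y => (h'.isPOVM l.2 y).isPositive,
    fun y => (h'.isPOVM l.2 y).sum_eq_one⟩, σ, hw, hw_sum, hσ,
    hasSum_smul_postMeasurement p fun a b x y => hsum (x, y) (a, b)⟩

end PostMeasurement

section InvariantSubspaces

variable {H H' : Type*} [NormedAddCommGroup H] [InnerProductSpace ℂ H]
  [NormedAddCommGroup H'] [InnerProductSpace ℂ H']

theorem nonempty_linearIsometry_of_finrank_le [FiniteDimensional ℂ H] [FiniteDimensional ℂ H']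
    (h : Module.finrank ℂ H ≤ Module.finrank ℂ H') : Nonempty (H →ₗᵢ[ℂ] H') := by
  let b := stdOrthonormalBasis ℂ H
  let b' := stdOrthonormalBasis ℂ H'
  let f : H →ₗ[ℂ] H' := b.toBasis.constr ℂ (b' ∘ Fin.castLE h)
  have hf : f ∘ b.toBasis = b' ∘ Fin.castLE h := funext (b.toBasis.constr_basis ℂ _)
  have hb : Orthonormal ℂ b.toBasis := by simp only [OrthonormalBasis.coe_toBasis, b.orthonormal]
  exact ⟨f.isometryOfOrthonormal hb (hf ▸ b'.orthonormal.comp _ (Fin.castLE_injective h))⟩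

theorem starProjection_apply_of_orthogonalFamily {ι : Type*} {U : ι → Submodule ℂ H}
    [∀ i, (U i).HasOrthogonalProjection]
    (hU : OrthogonalFamily ℂ (fun i => U i) fun i => (U i).subtypeₗᵢ) {f : ∀ i, U i} {v : H}
    (hf : HasSum (fun i => (f i : H)) v) (i : ι) : (U i).starProjection v = f i := by
  have hsingle : HasSum (fun j => (U i).starProjection (f j)) ((U i).starProjection (f i)) := by
    refine hasSum_single i fun j hj => (Submodule.starProjection_apply_eq_zero_iff _).mpr ?_
    exact (Submodule.mem_orthogonal _ _).mpr fun u hu => hU hj.symm ⟨u, hu⟩ (f j)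
  rw [(hf.mapL (U i).starProjection).unique hsingle]
  exact Submodule.starProjection_eq_self_iff.mpr (f i).2

variable [CompleteSpace H]

theorem exists_adjoint_comp_self_eq_starProjection [FiniteDimensional ℂ H'] [CompleteSpace H']
    (U : Submodule ℂ H) [FiniteDimensional ℂ U]
    (hU : Module.finrank ℂ U ≤ Module.finrank ℂ H') :
    ∃ C : H →L[ℂ] H', adjoint C ∘L C = U.starProjection := by
  have : CompleteSpace U := FiniteDimensional.complete ℂ U
  obtain ⟨J⟩ := nonempty_linearIsometry_of_finrank_le hU
  have hJ : adjoint J.toContinuousLinearMap ∘L J.toContinuousLinearMap = 1 :=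
    (norm_map_iff_adjoint_comp_self _).mp J.norm_map
  refine ⟨J.toContinuousLinearMap ∘L U.orthogonalProjectionOnto, ?_⟩
  rw [adjoint_comp, Submodule.adjoint_orthogonalProjectionOnto, comp_assoc,
    ← comp_assoc (adjoint J.toContinuousLinearMap), hJ]
  rfl

variable [CompleteSpace H']

theorem comp_starProjection_of_adjoint_comp_self {U : Submodule ℂ H} [U.HasOrthogonalProjection]
    {C : H →L[ℂ] H'} (hC : adjoint C ∘L C = U.starProjection) : C ∘L U.starProjection = C := by
  ext1 v
  have hker : adjoint C (C (U.starProjection v - v)) = 0 := by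
    rw [← comp_apply, hC, map_sub, Submodule.starProjection_eq_self_iff.mpr
      (Submodule.starProjection_apply_mem U v), sub_self]
  rw [comp_apply, ← sub_eq_zero, ← map_sub, ← inner_self_eq_zero (𝕜 := ℂ), ← adjoint_inner_right,
    hker, inner_zero_right]

variable {A : Type*} [DecidableEq A]

/-- The operators `C M_a C†` obtained from the operators `M_a` by a partial isometry `C`, completed
by assigning the projection `1 - C C†` onto the complement of the range of `C` to the outcome
`a₀`. -/
def partialIsometryConj (C : H →L[ℂ] H') (a₀ : A) (M : A → H →L[ℂ] H) (a : A) : H' →L[ℂ] H' :=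
  C ∘L M a ∘L adjoint C + Pi.single (M := fun _ => H' →L[ℂ] H') a₀ (1 - C ∘L adjoint C) a

theorem isStarProjection_comp_adjoint {C : H →L[ℂ] H'} (hC : C ∘L adjoint C ∘L C = C) :
    IsStarProjection (C ∘L adjoint C) := by
  refine ⟨?_, (isPositive_self_comp_adjoint C).isSelfAdjoint⟩
  rw [IsIdempotentElem, mul_def, comp_assoc, ← comp_assoc (adjoint C), ← comp_assoc C, hC]

theorem IsPOVM.partialIsometryConj [Fintype A] {M : A → H →L[ℂ] H} (hM : IsPOVM M)
    {C : H →L[ℂ] H'} (hC : C ∘L adjoint C ∘L C = C) (a₀ : A) :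
    IsPOVM (partialIsometryConj C a₀ M) where
  isPositive a := by
    refine ((hM.isPositive a).conj_adjoint C).add ?_
    obtain rfl | ha := eq_or_ne a a₀
    · rw [Pi.single_eq_same]
      exact IsPositive.of_isStarProjection (isStarProjection_comp_adjoint hC).one_sub
    · rw [Pi.single_eq_of_ne ha]
      exact isPositive_zero
  sum_eq_one := by
    have hconj : ∑ a, C ∘L M a ∘L adjoint C = C ∘L adjoint C := by
      rw [← comp_finsetSum, ← finsetSum_comp, hM.sum_eq_one]
      rfl
    simp only [BellStrategy.partialIsometryConj, Finset.sum_add_distrib, hconj]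
    rw [Finset.sum_pi_single', if_pos (Finset.mem_univ a₀), add_sub_cancel]

theorem adjoint_comp_partialIsometryConj_comp {C : H →L[ℂ] H'} (hC : C ∘L adjoint C ∘L C = C)
    (a₀ : A) (M : A → H →L[ℂ] H) (a : A) :
    adjoint C ∘L partialIsometryConj C a₀ M a ∘L C =
      (adjoint C ∘L C) ∘L M a ∘L adjoint C ∘L C := by
  have hzero : Pi.single (M := fun _ => H' →L[ℂ] H') a₀ (1 - C ∘L adjoint C) a ∘L C = 0 := by
    obtain rfl | ha := eq_or_ne a a₀
    · rw [Pi.single_eq_same, sub_comp, comp_assoc, hC, one_def, id_comp, sub_self]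
    · rw [Pi.single_eq_of_ne ha, zero_comp]
  rw [partialIsometryConj, add_comp, hzero, add_zero]
  rfl

theorem exists_isCStarCombination_of_invariant {ι X A : Type*} [Fintype A] [Nonempty A]
    [FiniteDimensional ℂ H'] {M : X → A → H →L[ℂ] H} (hM : ∀ x, IsPOVM (M x))
    {U : ι → Submodule ℂ H} [∀ i, FiniteDimensional ℂ (U i)]
    (hU : ∀ i, Module.finrank ℂ (U i) ≤ Module.finrank ℂ H')
    (hinv : ∀ x a i, ∀ v ∈ U i, M x a v ∈ U i)
    (hs : ∀ v, HasSum (fun i => (U i).starProjection v) v) :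
    ∃ (C : ι → H →L[ℂ] H') (Q : ι → X → A → H' →L[ℂ] H'), IsCStarCombination M C Q := by
  classical
  obtain ⟨a₀⟩ := ‹Nonempty A›
  choose C hC using fun i => exists_adjoint_comp_self_eq_starProjection (U i) (hU i)
  have hCC (i : ι) : C i ∘L adjoint (C i) ∘L C i = C i := by
    rw [hC, comp_starProjection_of_adjoint_comp_self (hC i)]
  refine ⟨C, fun i x => partialIsometryConj (C i) a₀ (M x), fun i x =>
    (hM x).partialIsometryConj (hCC i) a₀, fun x a u v => ?_⟩
  have hmem (i : ι) : (U i).starProjection (M x a ((U i).starProjection v)) =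
      M x a ((U i).starProjection v) :=
    Submodule.starProjection_eq_self_iff.mpr
      (hinv x a i _ (Submodule.starProjection_apply_mem (U i) v))
  simpa only [adjoint_comp_partialIsometryConj_comp (hCC _), hC, comp_apply, hmem,
    innerSL_apply_apply] using
    ((hs v).mapL (M x a)).mapL (innerSL ℂ u)

theorem hasSum_starProjection_of_isHilbertSum {ι : Type*} {U : ι → Submodule ℂ H}
    [∀ i, (U i).HasOrthogonalProjection]
    (hU : IsHilbertSum ℂ (fun i => U i) fun i => (U i).subtypeₗᵢ) (v : H) :
    HasSum (fun i => (U i).starProjection v) v := by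
  classical
  have hv := hU.hasSum_linearIsometryEquiv_symm (hU.linearIsometryEquiv v)
  rw [LinearIsometryEquiv.symm_apply_apply] at hv
  simpa only [starProjection_apply_of_orthogonalFamily hU.OrthogonalFamily hv,
    Submodule.coe_subtypeₗᵢ, Submodule.subtype_apply] using hv

end InvariantSubspaces

section Jordan

section Algebra

variable {𝕜 V : Type*} [Field 𝕜] [AddCommGroup V] [Module 𝕜 V] {P Q : V →ₗ[𝕜] V}

/-- The operator `P + Q - PQ - QP`, which is `(P - Q)²` when `Q` is idempotent as well, commutes
with `P`. Hence the image under `P` of one of its eigenvectors is another one, unless it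
vanishes. -/
theorem exists_common_eigenvector_of_isIdempotentElem [IsAlgClosed 𝕜] (hP : IsIdempotentElem P)
    {W : Submodule 𝕜 V} [FiniteDimensional 𝕜 W] (hW : W ≠ ⊥) (hPW : ∀ v ∈ W, P v ∈ W)
    (hQW : ∀ v ∈ W, Q v ∈ W) :
    ∃ v ∈ W, v ≠ 0 ∧ ∃ ε μ : 𝕜, P v = ε • v ∧ P v + Q v - P (Q v) - Q (P v) = μ • v := by
  have hinv (v : V) (hv : v ∈ W) : (P + Q - P * Q - Q * P) v ∈ W :=
    W.sub_mem (W.sub_mem (W.add_mem (hPW v hv) (hQW v hv)) (hPW _ (hQW v hv))) (hQW _ (hPW v hv))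
  have := (Submodule.nontrivial_iff_ne_bot (p := W)).mpr hW
  obtain ⟨μ, hμ⟩ := Module.End.exists_eigenvalue ((P + Q - P * Q - Q * P).restrict hinv)
  obtain ⟨⟨w, hw⟩, hwμ, hw0⟩ := hμ.exists_hasEigenvector
  have hwμ : P w + Q w - P (Q w) - Q (P w) = μ • w :=
    congrArg Subtype.val (Module.End.mem_eigenspace_iff.mp hwμ)
  have hPP (v : V) : P (P v) = P v := congrArg (fun R : V →ₗ[𝕜] V => R v) hP
  by_cases hPw : P w = 0
  · exact ⟨w, hw, fun h => hw0 (Subtype.ext h), 0, μ, by rw [hPw, zero_smul], hwμ⟩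
  · refine ⟨P w, hPW w hw, hPw, 1, μ, by rw [hPP, one_smul], ?_⟩
    rw [← map_smul, ← hwμ, map_sub, map_sub, map_add, hPP, hPP]
    abel

theorem exists_invariant_finrank_le_two_of_isIdempotentElem [IsAlgClosed 𝕜]
    (hP : IsIdempotentElem P) (hQ : IsIdempotentElem Q) {W : Submodule 𝕜 V}
    [FiniteDimensional 𝕜 W] (hW : W ≠ ⊥) (hPW : ∀ v ∈ W, P v ∈ W) (hQW : ∀ v ∈ W, Q v ∈ W) :
    ∃ U ≤ W, U ≠ ⊥ ∧ Module.finrank 𝕜 U ≤ 2 ∧ (∀ v ∈ U, P v ∈ U) ∧ ∀ v ∈ U, Q v ∈ U := by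
  classical
  obtain ⟨v, hv, hv0, ε, μ, hPv, hμ⟩ :=
    exists_common_eigenvector_of_isIdempotentElem hP hW hPW hQW
  set U := Submodule.span 𝕜 {v, Q v}
  have hvU : v ∈ U := Submodule.subset_span (Set.mem_insert v _)
  have hQvU : Q v ∈ U := Submodule.subset_span (Set.mem_insert_of_mem v rfl)
  have hQQv : Q (Q v) = Q v := congrArg (fun R : V →ₗ[𝕜] V => R v) hQ
  have hPQv : P (Q v) = ε • v + Q v - ε • Q v - μ • v := by
    rw [← hμ, hPv, map_smul]
    abel
  have hspan {T : V →ₗ[𝕜] V} (hT : T v ∈ U) (hTQ : T (Q v) ∈ U) : ∀ u ∈ U, T u ∈ U :=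
    fun _ hu => (Submodule.span_le.mpr (Set.pair_subset hT hTQ) : U ≤ U.comap T) hu
  refine ⟨U, Submodule.span_le.mpr (Set.pair_subset hv (hQW v hv)),
    fun h => hv0 ((Submodule.mem_bot 𝕜).mp (h ▸ hvU)), ?_, hspan ?_ ?_, hspan hQvU ?_⟩
  · have hcard := finrank_span_finset_le_card (R := 𝕜) ({v, Q v} : Finset V)
    rw [Set.finrank, Finset.coe_pair] at hcard
    exact hcard.trans Finset.card_le_two
  · exact hPv ▸ U.smul_mem ε hvU
  · exact hPQv ▸ U.sub_mem (U.sub_mem (U.add_mem (U.smul_mem ε hvU) hQvU) (U.smul_mem ε hQvU))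
      (U.smul_mem μ hvU)
  · exact hQQv.symm ▸ hQvU

end Algebra

variable {H : Type*} [NormedAddCommGroup H] [InnerProductSpace ℂ H]

theorem starProjection_eq_add_of_le {U W : Submodule ℂ H} [U.HasOrthogonalProjection]
    [W.HasOrthogonalProjection] [(Uᗮ ⊓ W).HasOrthogonalProjection] (hUW : U ≤ W) (v : H) :
    W.starProjection v = U.starProjection v + (Uᗮ ⊓ W).starProjection v := by
  have hU := Submodule.starProjection_apply_mem U v
  have hC := Submodule.starProjection_apply_mem (Uᗮ ⊓ W) v
  refine Submodule.eq_starProjection_of_mem_orthogonal (W.add_mem (hUW hU) hC.2) ?_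
  have hW : Wᗮ = Uᗮ ⊓ (Uᗮ ⊓ W)ᗮ := by
    rw [Submodule.inf_orthogonal, Submodule.sup_orthogonal_inf_of_hasOrthogonalProjection hUW]
  refine hW ▸ ⟨?_, ?_⟩
  · rw [← sub_sub]
    exact Uᗮ.sub_mem (U.sub_starProjection_mem_orthogonal v) hC.1
  · rw [add_comm, ← sub_sub]
    exact Submodule.sub_mem _ (Submodule.sub_starProjection_mem_orthogonal v)
      (Submodule.orthogonal_le inf_le_left (U.le_orthogonal_orthogonal hU))

theorem orthogonal_inf_lt {U W : Submodule ℂ H} (hUW : U ≤ W) (hU : U ≠ ⊥) : Uᗮ ⊓ W < W := by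
  refine lt_of_le_of_ne inf_le_right fun h => hU ?_
  exact Submodule.isOrtho_self.mp (hUW.trans (inf_eq_right.mp h))

theorem exists_sum_starProjection_eq [FiniteDimensional ℂ H] {p q : Submodule ℂ H → Prop}
    (hp : ∀ U W, p U → p W → p (Uᗮ ⊓ W))
    (hpq : ∀ W, p W → W ≠ ⊥ → ∃ U ≤ W, U ≠ ⊥ ∧ p U ∧ q U) (W : Submodule ℂ H) (hW : p W) :
    ∃ (ι : Type) (_ : Fintype ι) (U : ι → Submodule ℂ H), (∀ i, p (U i) ∧ q (U i)) ∧
      ∀ v, ∑ i, (U i).starProjection v = W.starProjection v := by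
  induction hn : Module.finrank ℂ W using Nat.strong_induction_on generalizing W with
  | _ n ih =>
    obtain rfl | hW0 := eq_or_ne W ⊥
    · exact ⟨Empty, inferInstance, Empty.elim, fun i => i.elim, fun v => by simp⟩
    obtain ⟨U, hUW, hU0, hU⟩ := hpq W hW hW0
    obtain ⟨ι, _, V, hV, hsum⟩ := ih _
      (hn ▸ Submodule.finrank_lt_finrank_of_lt (orthogonal_inf_lt hUW hU0)) (Uᗮ ⊓ W)
      (hp U W hU.1 hW) rfl
    refine ⟨Option ι, inferInstance, fun o => o.elim U V, Option.rec hU hV, fun v => ?_⟩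
    rw [Fintype.sum_option, starProjection_eq_add_of_le hUW, ← hsum]
    rfl

theorem mapsTo_orthogonal_of_isSelfAdjoint [CompleteSpace H] {T : H →L[ℂ] H}
    (hT : IsSelfAdjoint T) {U : Submodule ℂ H} (hU : ∀ v ∈ U, T v ∈ U) :
    ∀ v ∈ Uᗮ, T v ∈ Uᗮ := by
  refine fun v hv => (Submodule.mem_orthogonal U _).mpr fun u hu => ?_
  have hadj : adjoint T = T := hT
  rw [← adjoint_inner_left, hadj]
  exact (Submodule.mem_orthogonal U v).mp hv _ (hU u hu)

theorem exists_blocks_of_isStarProjection [FiniteDimensional ℂ H] {P Q : H →L[ℂ] H}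
    (hP : IsStarProjection P) (hQ : IsStarProjection Q) :
    ∃ (ι : Type) (_ : Fintype ι) (U : ι → Submodule ℂ H), (∀ i, Module.finrank ℂ (U i) ≤ 2) ∧
      (∀ i, ∀ v ∈ U i, P v ∈ U i) ∧ (∀ i, ∀ v ∈ U i, Q v ∈ U i) ∧
      ∀ v, HasSum (fun i => (U i).starProjection v) v := by
  have hsplit (W : Submodule ℂ H) (hW : (∀ v ∈ W, P v ∈ W) ∧ ∀ v ∈ W, Q v ∈ W) (hW0 : W ≠ ⊥) :
      ∃ U ≤ W, U ≠ ⊥ ∧ ((∀ v ∈ U, P v ∈ U) ∧ ∀ v ∈ U, Q v ∈ U) ∧ Module.finrank ℂ U ≤ 2 := by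
    obtain ⟨U, hUW, hU0, hU2, hUP, hUQ⟩ := exists_invariant_finrank_le_two_of_isIdempotentElem
      (P := (P : H →ₗ[ℂ] H)) (Q := (Q : H →ₗ[ℂ] H)) (congrArg toLinearMap hP.isIdempotentElem)
      (congrArg toLinearMap hQ.isIdempotentElem) hW0 hW.1 hW.2
    exact ⟨U, hUW, hU0, ⟨hUP, hUQ⟩, hU2⟩
  obtain ⟨ι, _, U, hU, hsum⟩ := exists_sum_starProjection_eq
    (p := fun U : Submodule ℂ H => (∀ v ∈ U, P v ∈ U) ∧ ∀ v ∈ U, Q v ∈ U)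
    (q := fun U => Module.finrank ℂ U ≤ 2)
    (fun U W hU hW =>
      ⟨fun v hv => ⟨mapsTo_orthogonal_of_isSelfAdjoint hP.isSelfAdjoint hU.1 v hv.1, hW.1 v hv.2⟩,
        fun v hv => ⟨mapsTo_orthogonal_of_isSelfAdjoint hQ.isSelfAdjoint hU.2 v hv.1, hW.2 v hv.2⟩⟩)
    hsplit ⊤ ⟨fun _ _ => trivial, fun _ _ => trivial⟩
  refine ⟨ι, inferInstance, U, fun i => (hU i).2, fun i => (hU i).1.1, fun i => (hU i).1.2,
    fun v => ?_⟩
  convert hasSum_fintype fun i => (U i).starProjection v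
  rw [hsum, Submodule.starProjection_eq_self_iff.mpr Submodule.mem_top]

end Jordan

section Effects

section ConvexCombinations

variable {H H' : Type*} [NormedAddCommGroup H] [InnerProductSpace ℂ H] [CompleteSpace H]
  [NormedAddCommGroup H'] [InnerProductSpace ℂ H'] [CompleteSpace H']
  {X A : Type*} [Fintype A] {M M' : X → A → H →L[ℂ] H}

theorem inner_adjoint_comp_sqrt_smul {s : ℝ} (hs : 0 ≤ s) (C : H →L[ℂ] H') (Q : H' →L[ℂ] H')
    (u v : H) :
    ⟪u, (adjoint ((√s : ℂ) • C) ∘L Q ∘L ((√s : ℂ) • C)) v⟫_ℂ =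
      s • ⟪u, (adjoint C ∘L Q ∘L C) v⟫_ℂ := by
  simp only [comp_apply, adjoint_inner_right, smul_apply, map_smul, inner_smul_left,
    inner_smul_right, Complex.conj_ofReal, Complex.real_smul]
  rw [← mul_assoc, ← Complex.ofReal_mul, Real.mul_self_sqrt hs]

theorem IsCStarCombination.smul_add_smul {ι κ : Type*} {C : ι → H →L[ℂ] H'}
    {C' : κ → H →L[ℂ] H'} {Q : ι → X → A → H' →L[ℂ] H'} {Q' : κ → X → A → H' →L[ℂ] H'}
    (h : IsCStarCombination M C Q) (h' : IsCStarCombination M' C' Q') {s t : ℝ} (hs : 0 ≤ s)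
    (ht : 0 ≤ t) :
    IsCStarCombination (s • M + t • M')
      (Sum.elim (fun i => (√s : ℂ) • C i) fun j => (√t : ℂ) • C' j) (Sum.elim Q Q') where
  isPOVM := Sum.rec h.isPOVM h'.isPOVM
  hasWeakSum x a u v := by
    have hadd : ⟪u, (s • M + t • M') x a v⟫_ℂ = s • ⟪u, M x a v⟫_ℂ + t • ⟪u, M' x a v⟫_ℂ := by
      simp only [Pi.add_apply, Pi.smul_apply, add_apply, smul_apply, inner_add_right,
        inner_smul_right_eq_smul]
    rw [hadd]
    refine HasSum.sum ?_ ?_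
    · simpa only [Function.comp_def, Sum.elim_inl, inner_adjoint_comp_sqrt_smul hs] using
        (h.hasWeakSum x a u v).const_smul s
    · simpa only [Function.comp_def, Sum.elim_inr, inner_adjoint_comp_sqrt_smul ht] using
        (h'.hasWeakSum x a u v).const_smul t

variable (H') in
/-- The POVMs `M x` form a C⋆-convex combination with finitely many terms of POVMs on `H'`. -/
def IsFinCStarCombination (M : X → A → H →L[ℂ] H) : Prop :=
  ∃ (ι : Type) (_ : Fintype ι) (C : ι → H →L[ℂ] H') (Q : ι → X → A → H' →L[ℂ] H'),
    IsCStarCombination M C Q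

theorem convex_isFinCStarCombination :
    Convex ℝ {M : X → A → H →L[ℂ] H | IsFinCStarCombination H' M} := by
  rintro M ⟨ι, _, C, Q, h⟩ M' ⟨κ, _, C', Q', h'⟩ s t hs ht -
  exact ⟨ι ⊕ κ, inferInstance, _, _, h.smul_add_smul h' hs ht⟩

end ConvexCombinations

variable {H : Type*} [NormedAddCommGroup H] [InnerProductSpace ℂ H]

/-- The two-outcome POVM `(E, 1 - E)` of an effect `0 ≤ E ≤ 1`. -/
def effectPOVM (E : H →L[ℂ] H) : Fin 2 → H →L[ℂ] H := ![E, 1 - E]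

theorem isPOVM_effectPOVM {E : H →L[ℂ] H} (h0 : E.IsPositive) (h1 : (1 - E).IsPositive) :
    IsPOVM (effectPOVM E) where
  isPositive := Fin.forall_fin_two.mpr ⟨h0, h1⟩
  sum_eq_one := by simp [effectPOVM]

theorem IsPOVM.one_eq_one_sub_zero {M : Fin 2 → H →L[ℂ] H} (hM : IsPOVM M) : M 1 = 1 - M 0 := by
  rw [← hM.sum_eq_one, Fin.sum_univ_two, add_sub_cancel_left]

theorem IsPOVM.effectPOVM_eq {M : Fin 2 → H →L[ℂ] H} (hM : IsPOVM M) : effectPOVM (M 0) = M :=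
  funext (Fin.forall_fin_two.mpr ⟨rfl, hM.one_eq_one_sub_zero.symm⟩)

theorem effectPOVM_smul_add_smul (E F : H →L[ℂ] H) {s t : ℝ} (hst : s + t = 1) :
    effectPOVM (s • E + t • F) = s • effectPOVM E + t • effectPOVM F := by
  refine funext (Fin.forall_fin_two.mpr ⟨rfl, ?_⟩)
  change 1 - (s • E + t • F) = s • (1 - E) + t • (1 - F)
  nth_rw 1 [← one_smul ℝ (1 : H →L[ℂ] H), ← hst]
  module

section Diagonal

variable {n : Type*} [Fintype n] (b : OrthonormalBasis n ℂ H)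

/-- The self-adjoint operator `∑ᵢ fᵢ |bᵢ⟩⟨bᵢ|`, as a linear function of the eigenvalues `f`. -/
def diagonalOperator : (n → ℝ) →ₗ[ℝ] H →L[ℂ] H :=
  Fintype.linearCombination ℝ fun i => InnerProductSpace.rankOne ℂ (b i) (b i)

theorem diagonalOperator_apply_basis (f : n → ℝ) (i : n) :
    diagonalOperator b f (b i) = (f i : ℂ) • b i := by
  classical
  have hterm (j : n) : (f j • InnerProductSpace.rankOne ℂ (b j) (b j)) (b i) =
      if j = i then (f i : ℂ) • b i else 0 := by
    rw [smul_apply, InnerProductSpace.rankOne_apply, orthonormal_iff_ite.mp b.orthonormal j i]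
    split_ifs with h
    · rw [h, one_smul, Complex.coe_smul]
    · rw [zero_smul, smul_zero]
  rw [diagonalOperator, Fintype.linearCombination_apply, sum_apply]
  simp only [hterm, Finset.sum_ite_eq', Finset.mem_univ, if_true]

theorem isStarProjection_diagonalOperator [CompleteSpace H] {f : n → ℝ}
    (hf : ∀ i, f i = 0 ∨ f i = 1) : IsStarProjection (diagonalOperator b f) where
  isIdempotentElem := ContinuousLinearMap.coe_injective <| b.toBasis.ext fun i => by
    rw [b.coe_toBasis, coe_coe, coe_coe, mul_apply_eq_comp, diagonalOperator_apply_basis, map_smul,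
      diagonalOperator_apply_basis, smul_smul]
    obtain h | h := hf i <;>
      simp only [h, Complex.ofReal_zero, Complex.ofReal_one, mul_one, mul_zero]
  isSelfAdjoint := by
    rw [diagonalOperator, Fintype.linearCombination_apply]
    exact isSelfAdjoint_sum _ fun i _ => (IsSelfAdjoint.all (f i)).smul
      (InnerProductSpace.isPositive_rankOne_self (b i)).isSelfAdjoint

/-- The cube `[0, 1]ⁿ` is the convex hull of its vertices, which are the spectra of projections. -/
theorem diagonalOperator_mem_convexHull [CompleteSpace H] {f : n → ℝ}
    (hf : ∀ i, f i ∈ Set.Icc 0 1) :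
    diagonalOperator b f ∈ convexHull ℝ {P : H →L[ℂ] H | IsStarProjection P} := by
  have hcube : f ∈ convexHull ℝ (Set.univ.pi fun _ : n => ({0, 1} : Set ℝ)) := by
    rw [convexHull_pi]
    intro i _
    rw [convexHull_pair, segment_eq_Icc zero_le_one]
    exact hf i
  refine convexHull_mono ?_
    ((diagonalOperator b).image_convexHull _ ▸ Set.mem_image_of_mem _ hcube)
  rintro _ ⟨g, hg, rfl⟩
  exact isStarProjection_diagonalOperator b fun i => hg i trivial

end Diagonal

variable [FiniteDimensional ℂ H]

theorem mem_convexHull_isStarProjection {E : H →L[ℂ] H} (h0 : E.IsPositive)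
    (h1 : (1 - E).IsPositive) : E ∈ convexHull ℝ {P : H →L[ℂ] H | IsStarProjection P} := by
  set b := h0.isSymmetric.eigenvectorBasis rfl
  set e := h0.isSymmetric.eigenvalues rfl
  have hb (i) : E (b i) = (e i : ℂ) • b i := h0.isSymmetric.apply_eigenvectorBasis rfl i
  have hE : diagonalOperator b e = E := ContinuousLinearMap.coe_injective <|
    b.toBasis.ext fun i => by
      rw [b.coe_toBasis, coe_coe, coe_coe, diagonalOperator_apply_basis, hb]
  rw [← hE]
  refine diagonalOperator_mem_convexHull b fun i => ?_
  have hnonneg := h0.re_inner_nonneg_right (b i)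
  have hle := h1.re_inner_nonneg_right (b i)
  simp only [sub_apply, one_apply_eq_self, inner_sub_right, hb, inner_smul_right,
    inner_self_eq_ofReal, b.norm_eq_one, map_sub] at hnonneg hle
  norm_num at hnonneg hle
  exact ⟨hnonneg, hle⟩

variable {H' : Type*} [NormedAddCommGroup H'] [InnerProductSpace ℂ H'] [FiniteDimensional ℂ H']

theorem isFinCStarCombination_of_isStarProjection (hH' : 2 ≤ Module.finrank ℂ H')
    {P : Fin 2 → H →L[ℂ] H} (hP : ∀ x, IsStarProjection (P x)) :
    IsFinCStarCombination H' fun x => effectPOVM (P x) := by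
  obtain ⟨ι, _, U, hU, hinv₀, hinv₁, hsum⟩ := exists_blocks_of_isStarProjection (hP 0) (hP 1)
  have hinv : ∀ x i, ∀ v ∈ U i, P x v ∈ U i := Fin.forall_fin_two.mpr ⟨hinv₀, hinv₁⟩
  refine ⟨ι, inferInstance, exists_isCStarCombination_of_invariant (fun x => isPOVM_effectPOVM
    (.of_isStarProjection (hP x)) (.of_isStarProjection (hP x).one_sub))
    (fun i => (hU i).trans hH') (fun x => Fin.forall_fin_two.mpr ⟨hinv x, fun i v hv => ?_⟩) hsum⟩
  exact (U i).sub_mem hv (hinv x i v hv)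

theorem isFinCStarCombination_of_isPOVM (hH' : 2 ≤ Module.finrank ℂ H')
    {M : Fin 2 → Fin 2 → H →L[ℂ] H} (hM : ∀ x, IsPOVM (M x)) : IsFinCStarCombination H' M := by
  have hmem : (fun x => M x 0) ∈
      convexHull ℝ (Set.univ.pi fun _ : Fin 2 => {P : H →L[ℂ] H | IsStarProjection P}) := by
    rw [convexHull_pi]
    exact fun x _ => mem_convexHull_isStarProjection ((hM x).isPositive 0)
      ((hM x).one_eq_one_sub_zero ▸ (hM x).isPositive 1)
  have hconv : Convex ℝ {E : Fin 2 → H →L[ℂ] H |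
      IsFinCStarCombination H' fun x => effectPOVM (E x)} := by
    intro E hE F hF s t hs ht hst
    have hcomb : (fun x => effectPOVM ((s • E + t • F) x)) =
        s • (fun x => effectPOVM (E x)) + t • fun x => effectPOVM (F x) :=
      funext fun x => effectPOVM_smul_add_smul (E x) (F x) hst
    change IsFinCStarCombination H' fun x => effectPOVM ((s • E + t • F) x)
    exact hcomb ▸ convex_isFinCStarCombination hE hF hs ht hst
  have hproj : (Set.univ.pi fun _ : Fin 2 => {P : H →L[ℂ] H | IsStarProjection P}) ⊆
      {E | IsFinCStarCombination H' fun x => effectPOVM (E x)} :=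
    fun P hP => isFinCStarCombination_of_isStarProjection hH' fun x => hP x trivial
  have hM_eq : (fun x => effectPOVM (M x 0)) = M := funext fun x => (hM x).effectPOVM_eq
  exact hM_eq ▸ convexHull_min hproj hconv hmem

end Effects

theorem IsQubitMixture.congr {Λ Λ' HE : Type*} [NormedAddCommGroup HE] [InnerProductSpace ℂ HE]
    [CompleteSpace HE] {p : Fin 2 × Fin 2 → ℝ} {τ : OutSpace HE →L[ℂ] OutSpace HE} (e : Λ' ≃ Λ)
    (h : IsQubitMixture Λ p τ) : IsQubitMixture Λ' p τ := by
  obtain ⟨w, S, σ, hw, hw1, hσ, hτ⟩ := h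
  refine ⟨fun l => w (e l), fun l => S (e l), fun l => σ (e l), fun l => hw (e l),
    e.hasSum_iff.mpr hw1, fun l => hσ (e l), ?_⟩
  rw [← e.hasSum_iff] at hτ
  exact hτ

end BellStrategy

end

theorem mainTheorem1_general {HA HB HE : Type*}
    [NormedAddCommGroup HA] [InnerProductSpace ℂ HA] [CompleteSpace HA]
    [NormedAddCommGroup HB] [InnerProductSpace ℂ HB] [CompleteSpace HB]
    [NormedAddCommGroup HE] [InnerProductSpace ℂ HE] [CompleteSpace HE]
    (p : Fin 2 × Fin 2 → ℝ) (S : BellStrategy.MeasurementStrategy HA HB)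
    {ρ : BellStrategy.HTensor (BellStrategy.HTensor HA HB) HE →L[ℂ]
      BellStrategy.HTensor (BellStrategy.HTensor HA HB) HE}
    (hρ : BellStrategy.IsDensity ρ) :
    (∀ {ι κ : Type*} (U : ι → Submodule ℂ HA) (V : κ → Submodule ℂ HB)
        [∀ i, FiniteDimensional ℂ (U i)] [∀ j, FiniteDimensional ℂ (V j)],
      (∀ i, Module.finrank ℂ (U i) ≤ 2) → (∀ j, Module.finrank ℂ (V j) ≤ 2) →
      IsHilbertSum ℂ (fun i => U i) (fun i => (U i).subtypeₗᵢ) →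
      IsHilbertSum ℂ (fun j => V j) (fun j => (V j).subtypeₗᵢ) →
      (∀ x a i, ∀ v ∈ U i, S.M x a v ∈ U i) → (∀ y b j, ∀ v ∈ V j, S.N y b v ∈ V j) →
        BellStrategy.IsQubitMixture (ι × κ) p (S.postMeasurement p ρ)) ∧
    (FiniteDimensional ℂ HA → FiniteDimensional ℂ HB →
      ∃ n : ℕ, BellStrategy.IsQubitMixture (Fin n) p (S.postMeasurement p ρ)) := by
  open BellStrategy in
  have hQubit : Module.finrank ℂ Qubit = 2 := finrank_euclideanSpace_fin
  refine ⟨fun U V _ _ hU2 hV2 hU hV hM hN => ?_, fun _ _ => ?_⟩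
  · obtain ⟨C, Q, hC⟩ := exists_isCStarCombination_of_invariant S.isPOVM_M
      (fun i => (hU2 i).trans_eq hQubit.symm) hM (hasSum_starProjection_of_isHilbertSum hU)
    obtain ⟨C', Q', hC'⟩ := exists_isCStarCombination_of_invariant S.isPOVM_N
      (fun j => (hV2 j).trans_eq hQubit.symm) hN (hasSum_starProjection_of_isHilbertSum hV)
    exact S.isQubitMixture hC hC' p hρ
  · obtain ⟨ι, _, C, Q, hC⟩ := isFinCStarCombination_of_isPOVM hQubit.ge S.isPOVM_M
    obtain ⟨κ, _, C', Q', hC'⟩ := isFinCStarCombination_of_isPOVM hQubit.ge S.isPOVM_N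
    exact ⟨Fintype.card (ι × κ),
      (S.isQubitMixture hC hC' p hρ).congr (Fintype.equivFin (ι × κ)).symm⟩

theorem mainTheorem1 {HA HB HE : Type*}
    [NormedAddCommGroup HA] [InnerProductSpace ℂ HA] [CompleteSpace HA]
    [NormedAddCommGroup HB] [InnerProductSpace ℂ HB] [CompleteSpace HB]
    [NormedAddCommGroup HE] [InnerProductSpace ℂ HE] [CompleteSpace HE]
    (p : Fin 2 × Fin 2 → ℝ) (hp : p ∈ stdSimplex ℝ (Fin 2 × Fin 2))
    (S : BellStrategy.MeasurementStrategy HA HB)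
    (ρ : BellStrategy.HTensor (BellStrategy.HTensor HA HB) HE →L[ℂ]
      BellStrategy.HTensor (BellStrategy.HTensor HA HB) HE)
    (hρ : BellStrategy.IsDensity ρ) :
    (∀ {ι κ : Type*} (D : BellStrategy.BlockDecomposition ι HA)
        (D' : BellStrategy.BlockDecomposition κ HB),
      S.IsBlockDiagonal D D' → BellStrategy.IsBlockState D D' ρ →
        BellStrategy.IsQubitMixture (ι × κ) p (S.postMeasurement p ρ)) ∧
    (FiniteDimensional ℂ HA → FiniteDimensional ℂ HB →
      ∃ n : ℕ, BellStrategy.IsQubitMixture (Fin n) p (S.postMeasurement p ρ)) := by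
  obtain ⟨hblock, hfin⟩ := mainTheorem1_general p S hρ
  exact ⟨fun D D' hD _ => hblock D.block D'.block (fun i => (D.finrank_block i).le)
    (fun j => (D'.finrank_block j).le) D.isHilbertSum D'.isHilbertSum hD.2.1 hD.2.2, hfin⟩
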